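/- Let $L\ge 4$ be a power of two, let $\mathcal L=\{0,\dots,L\}^2$, and write $N_\rho(A)=\{\vec x\in\mathbb R^2:\lVert\vec x-\vec y\rVert<\rho\text{ for some }\vec y\in A\}$. For $\vec a=(a_1,a_2)\in\{0,\dots,L-1\}^2$, the dissection $D(\vec a)$ is the following 4-ary tree of squares. Its root is $[-a_1-\tfrac12,\,2L-a_1-\tfrac12]\times[-a_2-\tfrac12,\,2L-a_2-\tfrac12]$, and every node of side length more than one has as its children the four equal squares into which it is partitioned. The grid lines of $D(\vec a)$ are the vertical lines through $(-a_1-\tfrac12+k,0)$ and the horizontal lines through $(0,-a_2-\tfrac12+k)$ for $k\in\{1,\dots,2L-1\}$; $G$ denotes their union. A boundary of $D(\vec a)$ is a border edge of a non-root node that is not contained in another border edge of a node of $D(\vec a)$. For a straight line segment $b$ and $k\ge 2$, $\mathrm{grid}(b,k,\delta)$ is the set of $k$ equispaced subsegments of length $\delta$ of $b$ (called portals) such that the two endpoints of $b$ lie in the first and in the last of them, respectively. A curve is the image of a continuous path in $\mathbb R^2$, $l$ denotes Euclidean length, $l(\mathcal S)=\sum_{s\in\mathcal S}l(s)$ for a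 finite family $\mathcal S$ of curves, and $s^\circ$ is the curve $s$ without its two endpoints. Let $\mathcal S=\{s_1,\dots,s_m\}$ be a finite family of straight line segments in the plane, each of which connects two points of $N_{1/4}(\mathcal L)$, and let $\vec a\in\{0,\dots,L-1\}^2$ be chosen uniformly at random. Then for every integer $r\ge 1$, every $\delta\in(0,1)$ and every $\delta'>0$, there is for every $\vec a$ a family $\mathcal S'=\{s_1',\dots,s_m'\}$ of curves of finite length, where $s_i'$ connects the same two endpoints as $s_i$, such that a) $s_i'$ differs from $s_i$ only in $N_{\delta'}(G)$, i.e. $s_i'\setminus N_{\delta'}(G)=s_i\setminus N_{\delta'}(G)$; b) if the $s_i^\circ$ are pairwise disjoint, then the $(s_i')^\circ$ are pairwise disjoint; c) every $s_i'$ intersects every boundary $b$ of $D(\vec a)$ only in the portals $\mathrm{grid}(b,r\log_2 L,\delta)$; d) $g_1\cap g_2\cap s_i'=\emptyset$ for every $i$ and all grid lines $g_1\ne g_2$; e) the curves of $\mathcal S'$ intersect the grid lines in only finitely many points; f) $\mathbb E_{\vec a}\left[l(\mathcal S')-l(\mathcal S)\right]\le 7\sqrt2\cdot\dfrac{l(\mathcal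 S)}{r}$. -/

import Mathlib

open Set
open scoped ENNReal

noncomputable section

namespace PortalSnapping

/-- The Euclidean plane. -/
abbrev Plane : Type := EuclideanSpace ℝ (Fin 2)

/-- The lattice points `{0, …, L}²`. -/
def lattice (L : ℕ) : Set Plane :=
  {z | ∃ i j : ℕ, i ≤ L ∧ j ≤ L ∧ z = !₂[(i : ℝ), (j : ℝ)]}

/-- The axis-parallel square `[x, x + side] × [y, y + side]`. -/
structure Square where
  x : ℝ
  y : ℝ
  side : ℝ

/-- The four equal sized squares into which a square is partitioned. -/
def Square.children (S : Square) : Set Square :=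
  {⟨S.x, S.y, S.side / 2⟩,
   ⟨S.x + S.side / 2, S.y, S.side / 2⟩,
   ⟨S.x, S.y + S.side / 2, S.side / 2⟩,
   ⟨S.x + S.side / 2, S.y + S.side / 2, S.side / 2⟩}

/-- The four border edges (bottom, top, left, right), each given by its pair of endpoints. -/
def Square.borderEdges (S : Square) : Set (Plane × Plane) :=
  {(!₂[S.x, S.y], !₂[S.x + S.side, S.y]),
   (!₂[S.x, S.y + S.side], !₂[S.x + S.side, S.y + S.side]),
   (!₂[S.x, S.y], !₂[S.x, S.y + S.side]),
   (!₂[S.x + S.side, S.y], !₂[S.x + S.side, S.y + S.side])}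

/-- The root square `C(a) = [-a₁ - 1/2, 2L - a₁ - 1/2] × [-a₂ - 1/2, 2L - a₂ - 1/2]`. -/
def rootSquare {L : ℕ} (a : Fin L × Fin L) : Square :=
  ⟨-(a.1 : ℝ) - 1 / 2, -(a.2 : ℝ) - 1 / 2, 2 * L⟩

/-- The nodes of the dissection `D(a)`: the root is `C(a)`, and every node of side length more
than one has its four quarter squares as children. -/
inductive IsNode {L : ℕ} (a : Fin L × Fin L) : Square → Prop
  | root : IsNode a (rootSquare a)
  | child {S T : Square} (hS : IsNode a S) (hside : 1 < S.side) (hT : T ∈ S.children) :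
      IsNode a T

/-- A boundary of `D(a)`: a border edge of a non-root node that is not contained in another
border edge (of any node, the root included). -/
def IsBoundary {L : ℕ} (a : Fin L × Fin L) (b : Plane × Plane) : Prop :=
  (∃ S : Square, IsNode a S ∧ S ≠ rootSquare a ∧ b ∈ S.borderEdges) ∧
  ∀ T : Square, IsNode a T → ∀ e ∈ T.borderEdges,
    segment ℝ b.1 b.2 ⊆ segment ℝ e.1 e.2 → segment ℝ e.1 e.2 = segment ℝ b.1 b.2

/-- The grid lines of `D(a)`: the vertical lines through `(-a₁ - 1/2 + k, 0)` and the horizontal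
lines through `(0, -a₂ - 1/2 + k)`, for `k = 1, …, 2L - 1`. -/
def gridLines {L : ℕ} (a : Fin L × Fin L) : Set (Set Plane) :=
  {g | ∃ k : ℕ, 1 ≤ k ∧ k < 2 * L ∧
    (g = {z : Plane | z 0 = -(a.1 : ℝ) - 1 / 2 + k} ∨
     g = {z : Plane | z 1 = -(a.2 : ℝ) - 1 / 2 + k})}

/-- The union of all grid lines of `D(a)`. -/
def gridUnion {L : ℕ} (a : Fin L × Fin L) : Set Plane := ⋃₀ gridLines a

/-- The point of the segment from `b.1` to `b.2` at distance `t` from `b.1`. -/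
def pointAt (b : Plane × Plane) (t : ℝ) : Plane :=
  AffineMap.lineMap b.1 b.2 (t / dist b.1 b.2)

/-- The set covered by `grid(b, k, δ)`, for `k ≥ 2`: `k` equispaced subsegments of length `δ` of
the segment `b`, of which the first starts at one endpoint of `b` and the last ends at the
other. -/
def portals (b : Plane × Plane) (k : ℕ) (δ : ℝ) : Set Plane :=
  {z | ∃ j : ℕ, j < k ∧
    z ∈ segment ℝ (pointAt b (j * ((dist b.1 b.2 - δ) / ((k : ℝ) - 1))))
      (pointAt b (j * ((dist b.1 b.2 - δ) / ((k : ℝ) - 1)) + δ))}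

/-- The Euclidean length of a curve. -/
def curveLength {p q : Plane} (γ : Path p q) : ℝ≥0∞ := eVariationOn γ univ

end PortalSnapping

end

open PortalSnapping

/-! Count grid lines and positions from the corner of the root square. All boundaries on line `n`
have the same length `N = gcd(n, L)`: they are intervals `[cN, (c+1)N]` (`cell`,
`IsBoundary.exists_isEdge`). Each crossing of a segment with this line is moved along the line, by
`snapMap`, to a nearby portal of its boundary. The move is spread over the strip of half-width `ε`
around the line: a point of the strip is displaced parallel to the line by the full move times a
tent function of its distance from the line.

No intersections are created within a strip because `snapMap` is strictly increasing. The coordinate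
along the line is a convex combination of the old and the new crossing position plus a slope term of
size `O(ε)`, so for small `ε` the order of distinct crossings survives.

The delicate points are the corners, where two perpendicular lines compete. A corner is given to the
line with the longer boundaries (`cellBeats`). Lengths are powers of two, so the corner is an
endpoint of boundaries on the losing line. A move passes no endpoint of a boundary on its own line,
so it only passes corners owned by that line (`Active.beats_of_mem`). A curve pushed past a corner
meets the losing line within `ε < δ` of an endpoint of a boundary, hence in a first or last portal
(`Fine.on_line`). Curves moved by different lines are kept apart by the same ownership rule
(`Near.far`), which gives `Fine.pt_eq_of_moved_eq`.

A move by `h` adds at most `2|h|` to the length, and `2|h|` is essentially at most `N/M` when there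
are `M + 1 = r log₂ L` portals. Under the random shift the mean of `N` is `(log₂ L + 2)/2`
(`sum_cell`), and a segment crosses at most `2√2` times its length many lines (`card_crossings_le`,
`sum_abs_le_norm`). The product is `O(l/r)`, with the constant checked in `cost_factor_le`. -/

namespace PortalSnapping

/-! ### The portal to which a crossing is moved -/

/-- The index of the portal that is nearest to the point `v`, among `M + 1` equispaced portals of
every interval `[c * N, (c + 1) * N]`. -/
noncomputable def portalIndex (N M : ℕ) (v : ℝ) : ℤ := round (M * Int.fract (v / N))

/-- A strictly increasing function that moves every real to the nearest portal of its interval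
`[c * N, (c + 1) * N)`. -/
noncomputable def snapMap (N M : ℕ) (θ v : ℝ) : ℝ :=
  -- The first two terms give the left end of a portal of length `θ`. The last term lies in
  -- `[θ/(3M), 2θ/(3M))`: it separates crossings that share a portal and keeps the value off the
  -- integers.
  N * ⌊v / N⌋ + portalIndex N M v * ((N - θ) / M) + θ * ((Int.fract (v / N) + 1) / (3 * M))

section

variable {N M : ℕ} {θ δ v : ℝ}

lemma round_mono' {x y : ℝ} (h : x ≤ y) : round x ≤ round y := by
  rw [round_eq, round_eq]
  exact Int.floor_mono (by linarith)

lemma portalIndex_nonneg : 0 ≤ portalIndex N M v := by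
  have h := round_mono' (mul_nonneg (Nat.cast_nonneg (α := ℝ) M) (Int.fract_nonneg (v / N)))
  rwa [round_zero] at h

lemma portalIndex_le : portalIndex N M v ≤ M := by
  have h : (M : ℝ) * Int.fract (v / N) ≤ ((M : ℤ) : ℝ) := by
    have := mul_le_mul_of_nonneg_left (Int.fract_lt_one (v / N)).le (Nat.cast_nonneg (α := ℝ) M)
    push_cast
    linarith
  have := round_mono' h
  rwa [round_intCast] at this

lemma eq_mul_floor_add (hN : 0 < N) : v = N * ⌊v / N⌋ + N * Int.fract (v / N) := by
  have hN' : (N : ℝ) ≠ 0 := by positivity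
  rw [← mul_add, Int.floor_add_fract]
  field_simp

lemma snapMap_mem (hN : 0 < N) (hM : 0 < M) (hθ : 0 < θ) (hθ1 : θ < 1) :
    N * ⌊v / N⌋ < snapMap N M θ v ∧ snapMap N M θ v < N * ⌊v / N⌋ + N := by
  have hN' : (1 : ℝ) ≤ N := by exact_mod_cast hN
  have hM' : (1 : ℝ) ≤ M := by exact_mod_cast hM
  have h0 := Int.fract_nonneg (v / N)
  have h1 := Int.fract_lt_one (v / N)
  have h2 : (0 : ℝ) ≤ portalIndex N M v := by exact_mod_cast portalIndex_nonneg
  have h3 : (portalIndex N M v : ℝ) ≤ M := by exact_mod_cast portalIndex_le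
  have h4 : 0 < (Int.fract (v / N) + 1) / (3 * M) := by positivity
  have h5 : (Int.fract (v / N) + 1) / (3 * M) < 1 := by
    rw [div_lt_one (by positivity)]; linarith
  have h6 : 0 ≤ portalIndex N M v * ((N - θ) / M) := by
    have : 0 ≤ (N : ℝ) - θ := by linarith
    positivity
  have h7 : portalIndex N M v * ((N - θ) / M) ≤ N - θ := by
    have : 0 ≤ (N : ℝ) - θ := by linarith
    rw [mul_div_left_comm]
    exact mul_le_of_le_one_right this ((div_le_one (by positivity)).2 h3)
  unfold snapMap
  constructor <;> nlinarith

/-- Values stay in the open interval of their own cell, which settles different cells. Inside a cell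
the rounded index is monotone and the small last term is strictly increasing. -/
lemma snapMap_strictMono (hN : 0 < N) (hM : 0 < M) (hθ : 0 < θ) (hθ1 : θ < 1) :
    StrictMono (snapMap N M θ) := by
  intro v w hvw
  have hN' : (1 : ℝ) ≤ N := by exact_mod_cast hN
  have hM' : (1 : ℝ) ≤ M := by exact_mod_cast hM
  have hlt : v / N < w / N := by gcongr
  rcases (Int.floor_mono hlt.le).lt_or_eq with h | h
  · have h1 : (⌊v / N⌋ : ℝ) + 1 ≤ ⌊w / N⌋ := by exact_mod_cast h
    have h2 := (snapMap_mem (v := v) hN hM hθ hθ1).2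
    have h3 := (snapMap_mem (v := w) hN hM hθ hθ1).1
    nlinarith
  · have hf : Int.fract (v / N) < Int.fract (w / N) := by
      unfold Int.fract; rw [h]; linarith
    have h1 : (portalIndex N M v : ℝ) ≤ portalIndex N M w := by
      exact_mod_cast round_mono' (mul_le_mul_of_nonneg_left hf.le (by positivity))
    have h2 : 0 ≤ ((N : ℝ) - θ) / M := div_nonneg (by linarith) (by positivity)
    have h3 : (Int.fract (v / N) + 1) / (3 * M) < (Int.fract (w / N) + 1) / (3 * M) := by
      gcongr
    unfold snapMap
    rw [h]
    have := mul_le_mul_of_nonneg_right h1 h2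
    have := mul_lt_mul_of_pos_left h3 hθ
    linarith

/-- The offset of `snapMap` from the equispaced points. -/
lemma snapMap_eq (hM : 0 < M) : snapMap N M θ v =
    N * ⌊v / N⌋ + portalIndex N M v * N / M
      + θ * ((Int.fract (v / N) + 1) / 3 - portalIndex N M v) / M := by
  have hM' : (M : ℝ) ≠ 0 := by positivity
  unfold snapMap
  field_simp
  ring

lemma abs_offset_le (hM : 0 < M) : |(Int.fract (v / N) + 1) / 3 - portalIndex N M v| ≤ M := by
  have hM' : (1 : ℝ) ≤ M := by exact_mod_cast hM
  have h0 := Int.fract_nonneg (v / N)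
  have h1 := Int.fract_lt_one (v / N)
  have h2 : (0 : ℝ) ≤ portalIndex N M v := by exact_mod_cast portalIndex_nonneg
  have h3 : (portalIndex N M v : ℝ) ≤ M := by exact_mod_cast portalIndex_le
  rw [abs_le]
  constructor <;> linarith

/-- Multiplying an integral value by `M` would make `θ * ((u + 1) / 3 - j)` an integer of absolute
value below one, hence zero. Then the integer `j` would equal `(u + 1) / 3`, which lies strictly
between 0 and 1. This is what keeps the curves off the corners. -/
lemma snapMap_ne_int (hM : 0 < M) (hθ : 0 < θ) (hθM : θ * M < 1) (z : ℤ) :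
    snapMap N M θ v ≠ z := by
  intro h
  have hM' : (0 : ℝ) < M := by positivity
  have h1 := abs_offset_le (N := N) (v := v) hM
  rw [snapMap_eq hM] at h
  set u := Int.fract (v / N) with hu
  set j := portalIndex N M v
  have h0 := Int.fract_nonneg (v / N)
  have h2 := Int.fract_lt_one (v / N)
  have h3 : θ * ((u + 1) / 3 - j) = ((M * (z - N * ⌊v / N⌋) - j * N : ℤ) : ℝ) := by
    push_cast
    field_simp at h ⊢
    linarith
  have h4 : |θ * ((u + 1) / 3 - j)| < 1 := by
    rw [abs_mul, abs_of_pos hθ]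
    exact (mul_le_mul_of_nonneg_left h1 hθ.le).trans_lt hθM
  rw [h3, ← Int.cast_abs] at h4
  have h5 : (M * (z - N * ⌊v / N⌋) - j * N : ℤ) = 0 := by
    rw [← Int.abs_lt_one_iff]; exact_mod_cast h4
  rw [h5, Int.cast_zero, mul_eq_zero] at h3
  have h6 : (u + 1) / 3 = j := by linarith [h3.resolve_left hθ.ne']
  have h7 : (0 : ℝ) < j := by rw [← h6]; linarith
  have h8 : (j : ℝ) < 1 := by rw [← h6]; linarith
  norm_cast at h7 h8
  omega

/-- Rounding among points at spacing `N / M` costs half a spacing; the remaining offset is at most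
`θ`. -/
lemma abs_snapMap_sub_le (hN : 0 < N) (hM : 0 < M) (hθ : 0 < θ) :
    |snapMap N M θ v - v| ≤ N / (2 * M) + θ := by
  have hN' : (0 : ℝ) < N := by positivity
  have hM' : (0 : ℝ) < M := by positivity
  have h1 := abs_offset_le (N := N) (v := v) hM
  have h2 := abs_sub_round (M * Int.fract (v / N))
  have h3 : snapMap N M θ v - v = N / M * (portalIndex N M v - M * Int.fract (v / N))
      + θ * (((Int.fract (v / N) + 1) / 3 - portalIndex N M v) / M) := by
    have h := eq_mul_floor_add (v := v) hN
    rw [snapMap_eq hM]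
    generalize portalIndex N M v = j
    generalize Int.fract (v / N) = u at h
    generalize ⌊v / N⌋ = c at h
    rw [h]
    field_simp
    ring
  rw [h3]
  refine (abs_add_le _ _).trans (add_le_add ?_ ?_)
  · rw [abs_mul, abs_of_pos (by positivity), abs_sub_comm]
    calc (N : ℝ) / M * |M * Int.fract (v / N) - portalIndex N M v| ≤ N / M * (1 / 2) := by
          gcongr
          exact h2
      _ = N / (2 * M) := by field_simp
  · rw [abs_mul, abs_of_pos hθ, abs_div, abs_of_pos hM']
    exact mul_le_of_le_one_right hθ.le ((div_le_one hM').2 h1)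

/-- The `j`-th portal of length `θ` lies in the `j`-th portal of length `δ`: their left ends differ
by `(δ - θ) * j / M`, which is between `0` and `δ - θ`. -/
lemma snapMap_mem_portal (hM : 0 < M) (hθ : 0 < θ) (hθδ : θ ≤ δ) :
    N * ⌊v / N⌋ + portalIndex N M v * ((N - δ) / M) ≤ snapMap N M θ v ∧
      snapMap N M θ v ≤ N * ⌊v / N⌋ + portalIndex N M v * ((N - δ) / M) + δ := by
  have hM' : (1 : ℝ) ≤ M := by exact_mod_cast hM
  have h0 := Int.fract_nonneg (v / N)
  have h1 := Int.fract_lt_one (v / N)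
  have h2 : (0 : ℝ) ≤ portalIndex N M v := by exact_mod_cast portalIndex_nonneg
  have h3 : (portalIndex N M v : ℝ) ≤ M := by exact_mod_cast portalIndex_le
  have h4 : 0 ≤ (Int.fract (v / N) + 1) / (3 * M) := by positivity
  have h5 : (Int.fract (v / N) + 1) / (3 * M) ≤ 1 := by
    rw [div_le_one (by positivity)]; linarith
  have h6 : snapMap N M θ v = N * ⌊v / N⌋ + portalIndex N M v * ((N - δ) / M)
      + (δ - θ) * (portalIndex N M v / M) + θ * ((Int.fract (v / N) + 1) / (3 * M)) := by
    unfold snapMap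
    field_simp
    ring
  have h7 : (portalIndex N M v : ℝ) / M ≤ 1 := (div_le_one (by positivity)).2 h3
  have h8 : 0 ≤ (portalIndex N M v : ℝ) / M := by positivity
  rw [h6]
  have := mul_le_of_le_one_right (sub_nonneg.2 hθδ) h7
  have := mul_nonneg (sub_nonneg.2 hθδ) h8
  have := mul_le_of_le_one_right hθ.le h5
  have := mul_nonneg hθ.le h4
  constructor <;> linarith

/-- The image is strictly inside the cell of `v`, so the only multiple of `N` that a move can touch
is its starting point. -/
lemma not_dvd_of_mem_uIcc_snapMap (hN : 0 < N) (hM : 0 < M) (hθ : 0 < θ) (hθ1 : θ < 1) {z : ℤ}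
    (hz : (z : ℝ) ∈ uIcc v (snapMap N M θ v)) (hne : (z : ℝ) ≠ v) : ¬ (N : ℤ) ∣ z := by
  rintro ⟨c, rfl⟩
  have hN' : (0 : ℝ) < N := by positivity
  obtain ⟨h1, h2⟩ := snapMap_mem (v := v) hN hM hθ hθ1
  have h3 := eq_mul_floor_add (v := v) hN
  have h4 := mul_nonneg hN'.le (Int.fract_nonneg (v / N))
  have h5 := mul_lt_mul_of_pos_left (Int.fract_lt_one (v / N)) hN'
  push_cast at hz hne
  rw [mem_uIcc] at hz
  have hc : c = ⌊v / N⌋ := by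
    apply le_antisymm
    · have : (N : ℝ) * c < N * (⌊v / N⌋ + 1) := by
        rcases hz with hz | hz <;> linarith
      have := lt_of_mul_lt_mul_left this hN'.le
      exact Int.lt_add_one_iff.1 (by exact_mod_cast this)
    · have : (N : ℝ) * ⌊v / N⌋ ≤ N * c := by
        rcases hz with hz | hz <;> linarith
      exact_mod_cast le_of_mul_le_mul_left this hN'
  subst hc
  rcases hz with hz | hz
  · exact hne (by linarith)
  · linarith

end

/-! ### The boundary lengths on the grid lines -/

/-- The length of the boundaries on the `n`-th grid line. -/
def cell (L : ℕ) (n : ℤ) : ℕ := Int.gcd n L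

section

variable {L : ℕ} {n m : ℤ}

lemma cell_pos (hL : 0 < L) : 0 < cell L n := Int.gcd_pos_of_ne_zero_right _ (by positivity)

lemma cell_dvd : (cell L n : ℤ) ∣ n := Int.gcd_dvd_left _ _

lemma cell_dvd_right : cell L n ∣ L := by
  have := Int.gcd_dvd_right n (L : ℤ)
  exact_mod_cast this

/-- Both lengths are powers of two, so the smaller divides the larger. -/
lemma cell_dvd_of_le (hL : ∃ e : ℕ, L = 2 ^ e) (h : cell L n ≤ cell L m) :
    (cell L n : ℤ) ∣ m := by
  obtain ⟨e, rfl⟩ := hL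
  obtain ⟨a, -, ha⟩ := (Nat.dvd_prime_pow Nat.prime_two).1 (cell_dvd_right (L := 2 ^ e) (n := n))
  obtain ⟨b, -, hb⟩ := (Nat.dvd_prime_pow Nat.prime_two).1 (cell_dvd_right (L := 2 ^ e) (n := m))
  have hab : cell (2 ^ e) n ∣ cell (2 ^ e) m := by
    rw [ha, hb] at h ⊢
    exact pow_dvd_pow 2 ((Nat.pow_le_pow_iff_right (by norm_num)).1 h)
  exact (Int.natCast_dvd_natCast.2 hab).trans cell_dvd

/-- The common point of the `n`-th line with normal direction `k` and the `m`-th perpendicular line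
belongs to the former. -/
def cellBeats (L : ℕ) (k : Fin 2) (n m : ℤ) : Prop :=
  cell L m < cell L n ∨ k = 0 ∧ cell L m = cell L n

lemma cellBeats_rev (k : Fin 2) : cellBeats L k.rev m n ↔ ¬ cellBeats L k n m := by
  unfold cellBeats
  have : k.rev = 0 ↔ ¬ k = 0 := by revert k; decide
  rw [this]
  by_cases h : k = 0 <;> simp [h] <;> omega

/-- On the losing line the corner is an endpoint of boundaries, so points of that line close to the
corner lie in a first or last portal. -/
lemma cellBeats.dvd (hL : ∃ e : ℕ, L = 2 ^ e) {k : Fin 2} (h : cellBeats L k n m) :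
    (cell L m : ℤ) ∣ n :=
  cell_dvd_of_le hL (h.elim le_of_lt fun h => h.2.le)

lemma cellBeats_of_not_dvd (hL : ∃ e : ℕ, L = 2 ^ e) {k : Fin 2} (h : ¬ (cell L n : ℤ) ∣ m) :
    cellBeats L k n m :=
  Or.inl (not_le.1 fun h' => h (cell_dvd_of_le hL h'))

/-- Doubling the modulus doubles the gcd at even arguments and contributes 1 at each odd argument,
which gives the recursion. -/
lemma sum_gcd_two_pow (e : ℕ) :
    2 * ∑ m ∈ Finset.range (2 ^ e), Nat.gcd m (2 ^ e) = 2 ^ e * (e + 2) := by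
  induction e with
  | zero => simp
  | succ e ih =>
    have h : ∀ K : ℕ, ∑ m ∈ Finset.range (2 * K), Nat.gcd m (2 ^ (e + 1)) =
        ∑ m ∈ Finset.range K, (2 * Nat.gcd m (2 ^ e) + 1) := by
      intro K
      induction K with
      | zero => simp
      | succ K ihK =>
        rw [mul_add, mul_one, Finset.sum_range_succ, Finset.sum_range_succ, ihK,
          Finset.sum_range_succ, add_assoc]
        congr 2
        · rw [pow_succ', Nat.gcd_mul_left]
        · have : Nat.Coprime (2 * K + 1) 2 := by simp
          exact this.pow_right _
    have h2 := h (2 ^ e)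
    rw [← pow_succ'] at h2
    rw [h2, Finset.sum_add_distrib, ← Finset.mul_sum, mul_add, ih]
    simp
    ring

/-- The gcd is periodic with period `2 ^ e`, so every window of that length has the same sum. Hence
the expected boundary length does not depend on which line is crossed. -/
lemma sum_cell (e : ℕ) (c : ℤ) :
    2 * ∑ a : Fin (2 ^ e), (cell (2 ^ e) (c + a) : ℝ) = 2 ^ e * (e + 2) := by
  have h : ∀ c : ℤ, ∑ a ∈ Finset.range (2 ^ e), cell (2 ^ e) (c + 1 + a) =
      ∑ a ∈ Finset.range (2 ^ e), cell (2 ^ e) (c + a) := by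
    intro c
    have h1 := Finset.sum_range_succ (fun a : ℕ => cell (2 ^ e) (c + a)) (2 ^ e)
    have h2 := Finset.sum_range_succ' (fun a : ℕ => cell (2 ^ e) (c + a)) (2 ^ e)
    have h3 : cell (2 ^ e) (c + ((2 ^ e : ℕ) : ℤ)) = cell (2 ^ e) (c + ((0 : ℕ) : ℤ)) := by
      simp [cell]
    rw [h1, h3] at h2
    have h4 := Nat.add_right_cancel h2
    rw [h4]
    refine Finset.sum_congr rfl fun a _ => ?_
    congr 1
    push_cast
    ring
  have h0 : ∑ a ∈ Finset.range (2 ^ e), cell (2 ^ e) (c + a) =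
      ∑ a ∈ Finset.range (2 ^ e), cell (2 ^ e) a := by
    induction c using Int.induction_on with
    | zero => simp
    | succ c ih => rw [h, ih]
    | pred c ih => rw [← ih, ← h]; simp
  have h1 := sum_gcd_two_pow e
  rw [Finset.sum_range (f := fun a => cell (2 ^ e) (c + a))] at h0
  have h2 : 2 * ∑ a : Fin (2 ^ e), cell (2 ^ e) (c + a) = 2 ^ e * (e + 2) := by
    rw [h0, ← h1]
    rfl
  exact_mod_cast h2

end

/-! ### The boundaries of the dissection -/

lemma eq_or_eq_rev (k l : Fin 2) : l = k ∨ l = k.rev := by revert k l; decide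

/-- The lower left corner of the root square. -/
noncomputable def corner {L : ℕ} (a : Fin L × Fin L) : Fin 2 → ℝ :=
  ![-(a.1 : ℝ) - 1 / 2, -(a.2 : ℝ) - 1 / 2]

/-- The square of side `2 ^ f` in the `i`-th column and the `j`-th row. -/
noncomputable def dyadicSquare {L : ℕ} (a : Fin L × Fin L) (f i j : ℕ) : Square :=
  ⟨corner a 0 + 2 ^ f * i, corner a 1 + 2 ^ f * j, 2 ^ f⟩

section

variable {L e : ℕ} {a : Fin L × Fin L}

lemma rootSquare_eq (hL : L = 2 ^ e) : rootSquare a = dyadicSquare a (e + 1) 0 0 := by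
  simp [rootSquare, dyadicSquare, corner, hL, pow_succ']

lemma dyadicSquare_children (f i j : ℕ) : (dyadicSquare a (f + 1) i j).children =
    {dyadicSquare a f (2 * i) (2 * j), dyadicSquare a f (2 * i + 1) (2 * j),
      dyadicSquare a f (2 * i) (2 * j + 1), dyadicSquare a f (2 * i + 1) (2 * j + 1)} := by
  have h1 : (2 : ℝ) ^ (f + 1) / 2 = 2 ^ f := by rw [pow_succ]; ring
  have h2 : ∀ c (m : ℕ), c + (2 : ℝ) ^ (f + 1) * m = c + 2 ^ f * (2 * m : ℕ) := by
    intro c m; rw [pow_succ]; push_cast; ring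
  have h3 : ∀ c (m : ℕ), c + (2 : ℝ) ^ (f + 1) * m + 2 ^ f = c + 2 ^ f * (2 * m + 1 : ℕ) := by
    intro c m; rw [pow_succ]; push_cast; ring
  simp only [Square.children, dyadicSquare, h1, h3]
  simp only [h2]

lemma IsNode.exists_eq (hL : L = 2 ^ e) {S : Square} (h : IsNode a S) :
    ∃ f i j : ℕ, f ≤ e + 1 ∧ 2 ^ f * i < 2 ^ (e + 1) ∧ 2 ^ f * j < 2 ^ (e + 1) ∧
      S = dyadicSquare a f i j := by
  induction h with
  | root => exact ⟨e + 1, 0, 0, le_rfl, by simp, by simp, rootSquare_eq hL⟩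
  | child hS hside hT ih =>
    obtain ⟨f, i, j, hf, hi, hj, rfl⟩ := ih
    cases f with
    | zero => simp [dyadicSquare] at hside
    | succ f =>
      rw [dyadicSquare_children] at hT
      have hlt : ∀ m, 2 ^ (f + 1) * m < 2 ^ (e + 1) →
          2 ^ f * (2 * m) < 2 ^ (e + 1) ∧ 2 ^ f * (2 * m + 1) < 2 ^ (e + 1) := by
        intro m hm
        obtain ⟨g, hg⟩ := Nat.exists_eq_add_of_le hf
        rw [hg, pow_add _ (f + 1)] at hm ⊢
        have h1 := lt_of_mul_lt_mul_left' hm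
        rw [pow_succ, mul_assoc]
        have h2 : 0 < 2 ^ f := by positivity
        exact ⟨Nat.mul_lt_mul_of_pos_left (by omega) h2, Nat.mul_lt_mul_of_pos_left (by omega) h2⟩
      simp only [mem_insert_iff, mem_singleton_iff] at hT
      obtain ⟨hi1, hi2⟩ := hlt i hi
      obtain ⟨hj1, hj2⟩ := hlt j hj
      rcases hT with rfl | rfl | rfl | rfl
      · exact ⟨f, _, _, by omega, hi1, hj1, rfl⟩
      · exact ⟨f, _, _, by omega, hi2, hj1, rfl⟩
      · exact ⟨f, _, _, by omega, hi1, hj2, rfl⟩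
      · exact ⟨f, _, _, by omega, hi2, hj2, rfl⟩

lemma isNode_dyadicSquare (hL : L = 2 ^ e) {f : ℕ} (hf : f ≤ e + 1) :
    ∀ {i j : ℕ}, 2 ^ f * i < 2 ^ (e + 1) → 2 ^ f * j < 2 ^ (e + 1) →
      IsNode a (dyadicSquare a f i j) := by
  induction hf using Nat.decreasingInduction with
  | self =>
    intro i j hi hj
    have hi' : i = 0 := by
      by_contra h
      exact absurd hi (not_lt.2 (Nat.le_mul_of_pos_right _ (Nat.pos_of_ne_zero h)))
    have hj' : j = 0 := by
      by_contra h
      exact absurd hj (not_lt.2 (Nat.le_mul_of_pos_right _ (Nat.pos_of_ne_zero h)))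
    rw [hi', hj', ← rootSquare_eq hL]
    exact IsNode.root
  | of_succ f hf ih =>
    intro i j hi hj
    have hlt : ∀ m, 2 ^ f * m < 2 ^ (e + 1) → 2 ^ (f + 1) * (m / 2) < 2 ^ (e + 1) := by
      intro m hm
      refine lt_of_le_of_lt ?_ hm
      rw [pow_succ, mul_assoc]
      exact Nat.mul_le_mul_left _ (Nat.mul_div_le m 2)
    refine IsNode.child (ih (hlt i hi) (hlt j hj)) ?_ ?_
    · exact one_lt_pow₀ (by norm_num) (by omega)
    · rw [dyadicSquare_children]
      have hi2 : i = 2 * (i / 2) ∨ i = 2 * (i / 2) + 1 := by omega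
      have hj2 : j = 2 * (j / 2) ∨ j = 2 * (j / 2) + 1 := by omega
      simp only [mem_insert_iff, mem_singleton_iff]
      rcases hi2 with hi2 | hi2 <;> rcases hj2 with hj2 | hj2 <;>
        rw [← hi2, ← hj2] <;> simp

end

/-- The segment `b` lies on the line `z k = u` and reaches from `l` to `r`. -/
structure IsEdge (b : Plane × Plane) (k : Fin 2) (u l r : ℝ) : Prop where
  fst : b.1 k = u
  snd : b.2 k = u
  fst_rev : b.1 k.rev = l
  snd_rev : b.2 k.rev = r

lemma plane_ext {z w : Plane} (k : Fin 2) (h : z k = w k) (h' : z k.rev = w k.rev) : z = w := by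
  ext l
  rcases eq_or_eq_rev k l with rfl | rfl <;> assumption

lemma IsEdge.mem_segment {b : Plane × Plane} {k : Fin 2} {u l r : ℝ} (h : IsEdge b k u l r)
    (hlr : l ≤ r) {z : Plane} : z ∈ segment ℝ b.1 b.2 ↔ z k = u ∧ l ≤ z k.rev ∧ z k.rev ≤ r := by
  constructor
  · rintro ⟨s, t, hs, ht, hst, rfl⟩
    simp only [PiLp.add_apply, PiLp.smul_apply, smul_eq_mul, h.fst, h.snd, h.fst_rev, h.snd_rev]
    obtain rfl : s = 1 - t := by linarith
    refine ⟨by ring, ?_, ?_⟩ <;> nlinarith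
  · rintro ⟨h1, h2, h3⟩
    have h4 : z k.rev ∈ segment ℝ l r := by rw [segment_eq_Icc hlr]; exact ⟨h2, h3⟩
    obtain ⟨s, t, hs, ht, hst, h5⟩ := h4
    refine ⟨s, t, hs, ht, hst, plane_ext k ?_ ?_⟩
    · simp only [PiLp.add_apply, PiLp.smul_apply, smul_eq_mul, h.fst, h.snd, h1]
      rw [← add_mul, hst, one_mul]
    · simpa only [PiLp.add_apply, PiLp.smul_apply, smul_eq_mul, h.fst_rev, h.snd_rev] using h5

section

variable {L e : ℕ} {a : Fin L × Fin L} {b : Plane × Plane} {f n c : ℕ} {k : Fin 2}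

lemma exists_isEdge_of_mem {i j : ℕ} (hf : f ≤ e + 1) (hi : 2 ^ f * i < 2 ^ (e + 1))
    (hj : 2 ^ f * j < 2 ^ (e + 1)) (hb : b ∈ (dyadicSquare a f i j).borderEdges) :
    ∃ k, ∃ n c : ℕ, 2 ^ f * n ≤ 2 ^ (e + 1) ∧ 2 ^ f * c < 2 ^ (e + 1) ∧
      IsEdge b k (corner a k + 2 ^ f * n) (corner a k.rev + 2 ^ f * c)
        (corner a k.rev + 2 ^ f * (c + 1)) := by
  have hlt : ∀ m, 2 ^ f * m < 2 ^ (e + 1) → 2 ^ f * (m + 1) ≤ 2 ^ (e + 1) := by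
    intro m hm
    obtain ⟨g, hg⟩ := Nat.exists_eq_add_of_le hf
    rw [hg, pow_add] at hm ⊢
    exact Nat.mul_le_mul_left _ (lt_of_mul_lt_mul_left' hm)
  simp only [Square.borderEdges, dyadicSquare, mem_insert_iff, mem_singleton_iff] at hb
  rcases hb with rfl | rfl | rfl | rfl
  · exact ⟨1, j, i, hj.le, hi, by constructor <;> simp [mul_add, add_assoc]⟩
  · exact ⟨1, j + 1, i, hlt j hj, hi, by constructor <;> simp [mul_add, add_assoc]⟩
  · exact ⟨0, i, j, hi.le, hj, by constructor <;> simp [mul_add, add_assoc]⟩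
  · exact ⟨0, i + 1, j, hlt i hi, hj, by constructor <;> simp [mul_add, add_assoc]⟩

lemma exists_node_isEdge (hL : L = 2 ^ e) (a : Fin L × Fin L) (k : Fin 2) (hf : f ≤ e + 1)
    (hn : 2 ^ f * n ≤ 2 ^ (e + 1)) (hc : 2 ^ f * c < 2 ^ (e + 1)) :
    ∃ T, IsNode a T ∧ ∃ b ∈ T.borderEdges,
      IsEdge b k (corner a k + 2 ^ f * n) (corner a k.rev + 2 ^ f * c)
        (corner a k.rev + 2 ^ f * (c + 1)) := by
  -- On the far side of the root no square starts at index `n`; there the right or top edge of the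
  -- last square is used.
  rcases hn.lt_or_eq with hn | hn
  · match k with
    | 0 =>
      refine ⟨_, isNode_dyadicSquare hL hf hn hc, _, Or.inr (Or.inr (Or.inl rfl)), ?_⟩
      constructor <;> simp [dyadicSquare, mul_add, add_assoc]
    | 1 =>
      refine ⟨_, isNode_dyadicSquare hL hf hc hn, _, Or.inl rfl, ?_⟩
      constructor <;> simp [dyadicSquare, mul_add, add_assoc]
  · obtain ⟨n, rfl⟩ : ∃ m, n = m + 1 := by
      refine Nat.exists_eq_succ_of_ne_zero ?_
      rintro rfl
      have : 0 < 2 ^ (e + 1) := by positivity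
      omega
    have hn' : 2 ^ f * n < 2 ^ (e + 1) := by
      rw [← hn]
      exact Nat.mul_lt_mul_of_pos_left (Nat.lt_succ_self n) (by positivity)
    match k with
    | 0 =>
      refine ⟨_, isNode_dyadicSquare hL hf hn' hc, _, Or.inr (Or.inr (Or.inr rfl)), ?_⟩
      constructor <;> simp [dyadicSquare, mul_add, add_assoc]
    | 1 =>
      refine ⟨_, isNode_dyadicSquare hL hf hc hn', _, Or.inr (Or.inl rfl), ?_⟩
      constructor <;> simp [dyadicSquare, mul_add, add_assoc]

/-- If the line also supports edges of length `2 ^ g`, the dyadic interval of that length around the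
boundary is an edge of some node, and maximality forces equality. So the length of a boundary is the
largest power of two its line admits. -/
lemma IsBoundary.le_of_dvd (hL : L = 2 ^ e) (hb : IsBoundary a b)
    (hn : 2 ^ f * n ≤ 2 ^ (e + 1)) (hc : 2 ^ f * c < 2 ^ (e + 1))
    (hE : IsEdge b k (corner a k + 2 ^ f * n) (corner a k.rev + 2 ^ f * c)
        (corner a k.rev + 2 ^ f * (c + 1))) {g : ℕ} (hfg : f ≤ g) (hg : g ≤ e + 1)
    (hdvd : 2 ^ g ∣ 2 ^ f * n) : g ≤ f := by
  obtain ⟨d, rfl⟩ := Nat.exists_eq_add_of_le hfg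
  obtain ⟨m, hm⟩ := hdvd
  set q := c / 2 ^ d with hq
  have h1 : 2 ^ d * q ≤ c := Nat.mul_div_le _ _
  have h2 : c + 1 ≤ 2 ^ d * (q + 1) := Nat.lt_mul_div_succ c (by positivity)
  obtain ⟨T, hT, b', hb', hE'⟩ := exists_node_isEdge (n := m) (c := q) hL a k hg (hm ▸ hn)
    (lt_of_le_of_lt (by rw [pow_add, mul_assoc]; exact Nat.mul_le_mul_left _ h1) hc)
  have h1' : (2 : ℝ) ^ (f + d) * q ≤ 2 ^ f * c := by
    rw [pow_add, mul_assoc]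
    exact mul_le_mul_of_nonneg_left (by exact_mod_cast h1) (by positivity)
  have h2' : (2 : ℝ) ^ f * (c + 1) ≤ 2 ^ (f + d) * (q + 1) := by
    rw [pow_add, mul_assoc]
    exact mul_le_mul_of_nonneg_left (by exact_mod_cast h2) (by positivity)
  have hm' : (2 : ℝ) ^ f * n = 2 ^ (f + d) * m := by exact_mod_cast hm
  have hpf : (0 : ℝ) < 2 ^ f := by positivity
  have hpg : (0 : ℝ) < 2 ^ (f + d) := by positivity
  have heq := hb.2 T hT b' hb' (fun z hz => by
    rw [hE.mem_segment (by linarith)] at hz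
    rw [hE'.mem_segment (by linarith)]
    exact ⟨by rw [hz.1, hm'], by linarith [hz.2.1], by linarith [hz.2.2]⟩)
  have hz1 := heq ▸ left_mem_segment ℝ b'.1 b'.2
  have hz2 := heq ▸ right_mem_segment ℝ b'.1 b'.2
  rw [hE.mem_segment (by linarith), hE'.fst_rev] at hz1
  rw [hE.mem_segment (by linarith), hE'.snd_rev] at hz2
  have h3 : (2 : ℝ) ^ (f + d) ≤ 2 ^ f := by linarith [hz1.2.1, hz2.2.2]
  exact (pow_le_pow_iff_right₀ (by norm_num)).1 h3

lemma IsBoundary.exists_isEdge (hL : ∃ e : ℕ, L = 2 ^ e) (hb : IsBoundary a b) :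
    ∃ k, ∃ n c : ℤ, 0 < n ∧ n < 2 * L ∧ IsEdge b k (corner a k + n)
      (corner a k.rev + cell L n * c) (corner a k.rev + cell L n * (c + 1)) := by
  obtain ⟨e, hL⟩ := hL
  obtain ⟨⟨S, hS, hroot, hmem⟩, -⟩ := id hb
  obtain ⟨f, i, j, hf, hi, hj, rfl⟩ := hS.exists_eq hL
  have hfe : f ≤ e := by
    by_contra h
    obtain rfl : f = e + 1 := by omega
    have h0 : ∀ m, 2 ^ (e + 1) * m < 2 ^ (e + 1) → m = 0 := fun m hm => by
      by_contra h
      exact absurd hm (not_lt.2 (Nat.le_mul_of_pos_right _ (Nat.pos_of_ne_zero h)))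
    rw [h0 i hi, h0 j hj] at hroot
    exact hroot (rootSquare_eq hL).symm
  obtain ⟨k, n, c, hn, hc, hE⟩ := exists_isEdge_of_mem hf hi hj hmem
  have hmax := fun g => hb.le_of_dvd hL hn hc hE (g := g)
  -- An edge on the outer border is contained in a root edge, which is longer; hence boundaries lie
  -- only on interior lines.
  have hn0 : 2 ^ f * n ≠ 0 := fun h0 => by
    have := hmax (e + 1) (by omega) le_rfl (by rw [h0]; exact dvd_zero _)
    omega
  have hn1 : 2 ^ f * n ≠ 2 ^ (e + 1) := fun h0 => by
    have := hmax (e + 1) (by omega) le_rfl (by rw [h0])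
    omega
  have hcell : cell L ((2 ^ f * n : ℕ) : ℤ) = 2 ^ f := by
    obtain ⟨g, hge, hg⟩ : ∃ g ≤ e, cell L ((2 ^ f * n : ℕ) : ℤ) = 2 ^ g :=
      (Nat.dvd_prime_pow Nat.prime_two).1 (by rw [← hL]; exact cell_dvd_right)
    have h1 : 2 ^ f ∣ 2 ^ g := by
      rw [← hg, cell, hL]
      exact Nat.dvd_gcd (by rw [Int.natAbs_natCast]; exact dvd_mul_right _ _)
        (pow_dvd_pow 2 hfe)
    have h2 : 2 ^ g ∣ 2 ^ f * n := by
      have := cell_dvd (L := L) (n := ((2 ^ f * n : ℕ) : ℤ))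
      rw [hg] at this
      exact_mod_cast this
    have h3 := hmax g ((Nat.pow_dvd_pow_iff_le_right (by norm_num)).1 h1) (by omega) h2
    rw [hg]
    congr 1
    exact le_antisymm h3 ((Nat.pow_dvd_pow_iff_le_right (by norm_num)).1 h1)
  refine ⟨k, (2 ^ f * n : ℕ), c, ?_, ?_, ?_⟩
  · exact_mod_cast Nat.pos_of_ne_zero hn0
  · rw [hL]
    rw [pow_succ'] at hn hn1
    exact_mod_cast lt_of_le_of_ne hn hn1
  · rw [hcell]
    push_cast
    exact hE

end

open Filter Topology

/-! ### Tent functions -/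

/-- The piecewise linear bump of height one supported on `[-ε, ε]`. -/
noncomputable def tent (ε u : ℝ) : ℝ := 1 - |max (-1) (min 1 (u / ε))|

lemma tent_of_abs_le {ε u : ℝ} (hε : 0 < ε) (h : |u| ≤ ε) : tent ε u = 1 - |u| / ε := by
  obtain ⟨h1, h2⟩ := abs_le.1 h
  have h3 : u / ε ≤ 1 := (div_le_one hε).2 h2
  have h4 : -1 ≤ u / ε := by rw [le_div_iff₀ hε]; linarith
  rw [tent, min_eq_right h3, max_eq_right h4, abs_div, abs_of_pos hε]

lemma tent_of_le_abs {ε u : ℝ} (hε : 0 < ε) (h : ε ≤ |u|) : tent ε u = 0 := by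
  rcases le_abs.1 h with h | h
  · have h3 : 1 ≤ u / ε := (one_le_div hε).2 h
    rw [tent, min_eq_left h3]; norm_num
  · have h3 : u / ε ≤ -1 := by rw [div_le_iff₀ hε]; linarith
    rw [tent, min_eq_right (h3.trans (by norm_num)), max_eq_left h3]; norm_num

lemma tent_nonneg (ε u : ℝ) : 0 ≤ tent ε u := by
  have : |max (-1) (min 1 (u / ε))| ≤ 1 :=
    abs_le.2 ⟨le_max_left _ _, max_le (by norm_num) (min_le_left _ _)⟩
  rw [tent]; linarith

lemma tent_le_one (ε u : ℝ) : tent ε u ≤ 1 := by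
  rw [tent]; linarith [abs_nonneg (max (-1) (min 1 (u / ε)))]

@[simp] lemma tent_zero (ε : ℝ) : tent ε 0 = 1 := by simp [tent]

lemma continuous_tent (ε : ℝ) : Continuous (tent ε) := by
  unfold tent; fun_prop

lemma lt_convex_combination {c u v τ : ℝ} (hu : c < u) (hv : c < v) (h0 : 0 ≤ τ) (h1 : τ ≤ 1) :
    c < (1 - τ) * u + τ * v :=
  convex_Ioi c hu hv (sub_nonneg.2 h1) h0 (sub_add_cancel _ _)

/-! ### Snapping the crossings of a family of segments with the integer grid -/

/-- A family of segments in the plane whose endpoints are far from the lines of the integer grid,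
together with maps that say where a crossing with a grid line is moved to along this line, and a
relation that says which of two perpendicular grid lines treats the segments through their
common point. -/
structure SnapData (ι : Type*) where
  start : ι → Fin 2 → ℝ
  dir : ι → Fin 2 → ℝ
  snap : ℤ → ℝ → ℝ
  beats : Fin 2 → ℤ → ℤ → Prop
  lines : Finset ℤ
  start_far : ∀ i k (n : ℤ), 1 / 4 ≤ |start i k - n|
  stop_far : ∀ i k (n : ℤ), 1 / 4 ≤ |start i k + dir i k - n|
  mem_lines : ∀ i k (n : ℤ), 0 < (n - start i k) / dir i k → (n - start i k) / dir i k < 1 →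
    n ∈ lines
  beats_rev : ∀ k n n', beats k.rev n' n ↔ ¬ beats k n n'
  snap_strictMono : ∀ n, StrictMono (snap n)
  snap_ne : ∀ n v (z : ℤ), snap n v ≠ z
  beats_of_mem : ∀ n k v (z : ℤ), (z : ℝ) ∈ uIcc v (snap n v) → (z : ℝ) ≠ v → beats k n z

namespace SnapData

variable {ι : Type*} (S : SnapData ι)

/-- The point with parameter `t` of the `i`-th segment. -/
def pt (i : ι) (t : ℝ) (k : Fin 2) : ℝ := S.start i k + t * S.dir i k

/-- The parameter at which the `i`-th segment crosses the grid line `z k = n`. -/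
noncomputable def time (i : ι) (k : Fin 2) (n : ℤ) : ℝ := (n - S.start i k) / S.dir i k

/-- The `i`-th segment crosses the grid line `z k = n`. -/
def Crosses (i : ι) (k : Fin 2) (n : ℤ) : Prop := 0 < S.time i k n ∧ S.time i k n < 1

/-- The position on the grid line `z k = n` at which it is crossed by the `i`-th segment. -/
noncomputable def pos (i : ι) (k : Fin 2) (n : ℤ) : ℝ := S.pt i (S.time i k n) k.rev

/-- The slope of the `i`-th segment over the `k`-th coordinate. -/
noncomputable def slope (i : ι) (k : Fin 2) : ℝ := S.dir i k.rev / S.dir i k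

/-- The crossing of the `i`-th segment with the line `z k = n` is moved along this line. -/
def Active (i : ι) (k : Fin 2) (n : ℤ) : Prop :=
  S.Crosses i k n ∧ ∀ z : ℤ, S.pos i k n = z → S.beats k n z

open Classical in
/-- The distance by which the crossing of the `i`-th segment with `z k = n` is moved. -/
noncomputable def shift (i : ι) (k : Fin 2) (n : ℤ) : ℝ :=
  if S.Active i k n then S.snap n (S.pos i k n) - S.pos i k n else 0

/-- The displacement of the points of the `i`-th segment with `k`-th coordinate `u`. -/
noncomputable def disp (ε : ℝ) (i : ι) (k : Fin 2) (u : ℝ) : ℝ :=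
  ∑ n ∈ S.lines, S.shift i k n * tent ε (u - n)

/-- The curve obtained from the `i`-th segment by moving its crossings with the grid lines. -/
noncomputable def moved (ε : ℝ) (i : ι) (t : ℝ) (k : Fin 2) : ℝ :=
  S.pt i t k + S.disp ε i k.rev (S.pt i t k.rev)

variable {S} {ε : ℝ} {i j : ι} {k : Fin 2} {n n' z : ℤ} {s t : ℝ}

/-! ### Crossings of the segments with grid lines -/

lemma Crosses.mem_lines (h : S.Crosses i k n) : n ∈ S.lines := S.mem_lines i k n h.1 h.2

/-- For a segment parallel to the line, division by zero makes `time` equal to 0, which the strict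
inequality in `Crosses` rules out. -/
lemma Crosses.dir_ne_zero (h : S.Crosses i k n) : S.dir i k ≠ 0 := by
  intro h0
  have := h.1
  simp [time, h0] at this

lemma Crosses.pt_time (h : S.Crosses i k n) : S.pt i (S.time i k n) k = n := by
  have := h.dir_ne_zero
  simp only [pt, time]
  field_simp
  ring

lemma Crosses.time_mem (h : S.Crosses i k n) : S.time i k n ∈ Icc (0 : ℝ) 1 :=
  ⟨h.1.le, h.2.le⟩

lemma Crosses.eq_pos_add (h : S.Crosses i k n) (t : ℝ) :
    S.pt i t k.rev = S.pos i k n + S.slope i k * (S.pt i t k - n) := by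
  have := h.dir_ne_zero
  simp only [pos, pt, time, slope]
  field_simp
  ring

/-- Both endpoints are at distance at least `1 / 4` from the line. If they were on the same side,
all of the segment would be. -/
lemma crosses_of_abs_lt (ht : t ∈ Icc (0 : ℝ) 1) (h : |S.pt i t k - n| < 1 / 4) :
    S.Crosses i k n := by
  have h0 := S.start_far i k n
  have h1 := S.stop_far i k n
  obtain ⟨ha, hb⟩ := abs_lt.1 h
  obtain ⟨ht0, ht1⟩ := ht
  unfold pt at ha hb
  set X := S.start i k
  set D := S.dir i k
  unfold Crosses time
  change 0 < (n - X) / D ∧ (n - X) / D < 1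
  rcases le_abs.1 h0 with h0 | h0 <;> rcases le_abs.1 h1 with h1 | h1
  · exfalso
    nlinarith
  · have hD : D < 0 := by linarith
    exact ⟨div_pos_of_neg_of_neg (by linarith) hD, by rw [div_lt_one_of_neg hD]; linarith⟩
  · have hD : 0 < D := by linarith
    exact ⟨div_pos (by linarith) hD, by rw [div_lt_one hD]; linarith⟩
  · exfalso
    nlinarith

lemma crosses_rev_of_pos_eq (h : S.Crosses i k n) (hz : S.pos i k n = z) :
    S.Crosses i k.rev z ∧ S.pos i k.rev z = n := by
  have h1 : S.Crosses i k.rev z := by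
    refine crosses_of_abs_lt h.time_mem ?_
    change |S.pos i k n - z| < _
    rw [hz]; norm_num
  refine ⟨h1, ?_⟩
  have h2 := h1.eq_pos_add (S.time i k n)
  rw [Fin.rev_rev, h.pt_time] at h2
  change _ = _ + _ * (S.pos i k n - z) at h2
  rw [hz] at h2
  linarith

lemma Active.shift_eq (h : S.Active i k n) :
    S.shift i k n = S.snap n (S.pos i k n) - S.pos i k n := by rw [shift, if_pos h]

/-- The relation `beats` holds at every corner in the range of a move. -/
lemma Active.beats_of_mem (h : S.Active i k n)
    (hz : (z : ℝ) ∈ uIcc (S.pos i k n) (S.snap n (S.pos i k n))) : S.beats k n z := by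
  by_cases h1 : (z : ℝ) = S.pos i k n
  · exact h.2 z h1.symm
  · exact S.beats_of_mem n k _ z hz h1

variable (S) in
/-- A bound for the slopes of all segments. -/
noncomputable def slopeBound [Fintype ι] : ℝ := ∑ i, ∑ k, |S.slope i k|

lemma abs_slope_le [Fintype ι] : |S.slope i k| ≤ S.slopeBound := by
  refine le_trans ?_ (Finset.single_le_sum (f := fun i => ∑ k, |S.slope i k|)
    (fun i _ => Finset.sum_nonneg fun k _ => abs_nonneg _) (Finset.mem_univ i))
  exact Finset.single_le_sum (f := fun k => |S.slope i k|)
    (fun k _ => abs_nonneg _) (Finset.mem_univ k)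

lemma slopeBound_nonneg [Fintype ι] : 0 ≤ S.slopeBound :=
  Finset.sum_nonneg fun _ _ => Finset.sum_nonneg fun _ _ => abs_nonneg _

variable (S) in
/-- The width `ε` is small compared to all distances between crossings and corners. -/
structure Fine [Fintype ι] (ε : ℝ) : Prop where
  pos : 0 < ε
  lt : ε < 1 / 4
  -- In a strip each of two segments deviates by at most `slopeBound * ε` from its convex
  -- combination, so a gap above twice that preserves their order.
  pos_sep : ∀ i j k, ∀ n ∈ S.lines, S.pos i k n < S.pos j k n →
    2 * S.slopeBound * ε < S.pos j k n - S.pos i k n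
  snap_sep : ∀ i j k, ∀ n ∈ S.lines, S.pos i k n < S.pos j k n →
    2 * S.slopeBound * ε < S.snap n (S.pos j k n) - S.snap n (S.pos i k n)
  pos_far : ∀ i k, ∀ n ∈ S.lines, ∀ z : ℤ, S.pos i k n ≠ z →
    (2 * S.slopeBound + 1) * ε < |S.pos i k n - z|
  snap_far : ∀ i k, ∀ n ∈ S.lines, ∀ z : ℤ,
    (2 * S.slopeBound + 1) * ε < |S.snap n (S.pos i k n) - z|
  shift_large : ∀ i k, ∀ n ∈ S.lines, S.snap n (S.pos i k n) ≠ S.pos i k n →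
    S.slopeBound * ε < |S.snap n (S.pos i k n) - S.pos i k n|

lemma eventually_mul_lt (c : ℝ) {η : ℝ} (hη : 0 < η) : ∀ᶠ ε in 𝓝[>] (0 : ℝ), c * ε < η := by
  have h : Tendsto (fun ε : ℝ => c * ε) (𝓝[>] 0) (𝓝 (c * 0)) :=
    ((continuous_const.mul continuous_id).tendsto 0).mono_left nhdsWithin_le_nhds
  rw [mul_zero] at h
  exact h.eventually (gt_mem_nhds hη)

lemma exists_pos_le_abs_sub_int (v : ℝ) : ∃ η > 0, ∀ z : ℤ, v ≠ z → η ≤ |v - z| := by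
  by_cases h : v = round v
  · refine ⟨1, one_pos, fun z hz => ?_⟩
    rw [h] at hz ⊢
    have : round v - z ≠ 0 := fun h0 => hz (by rw [sub_eq_zero.1 h0])
    exact_mod_cast Int.one_le_abs this
  · exact ⟨|v - round v|, abs_pos.2 (sub_ne_zero.2 h), fun z _ => round_le v z⟩

-- Each condition compares a multiple of `ε` with a positive number. There are finitely many
-- segments and lines, and one bound per position serves all integers `z`.
variable (S) in
lemma eventually_fine [Fintype ι] : ∀ᶠ ε in 𝓝[>] (0 : ℝ), S.Fine ε := by
  have h1 : ∀ᶠ ε in 𝓝[>] (0 : ℝ), 0 < ε := self_mem_nhdsWithin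
  have h2 : ∀ᶠ ε in 𝓝[>] (0 : ℝ), ε < 1 / 4 := by
    simpa using eventually_mul_lt 1 (η := 1 / 4) (by norm_num)
  have h3 : ∀ᶠ ε in 𝓝[>] (0 : ℝ), ∀ i j k, ∀ n ∈ S.lines, S.pos i k n < S.pos j k n →
      2 * S.slopeBound * ε < S.pos j k n - S.pos i k n := by
    simp only [eventually_all, eventually_all_finset]
    exact fun i j k n _ h => eventually_mul_lt _ (sub_pos.2 h)
  have h4 : ∀ᶠ ε in 𝓝[>] (0 : ℝ), ∀ i j k, ∀ n ∈ S.lines, S.pos i k n < S.pos j k n →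
      2 * S.slopeBound * ε < S.snap n (S.pos j k n) - S.snap n (S.pos i k n) := by
    simp only [eventually_all, eventually_all_finset]
    exact fun i j k n _ h => eventually_mul_lt _ (sub_pos.2 (S.snap_strictMono n h))
  have h5 : ∀ᶠ ε in 𝓝[>] (0 : ℝ), ∀ i k, ∀ n ∈ S.lines, ∀ z : ℤ, S.pos i k n ≠ z →
      (2 * S.slopeBound + 1) * ε < |S.pos i k n - z| := by
    simp only [eventually_all, eventually_all_finset]
    intro i k n _
    obtain ⟨η, hη, h⟩ := exists_pos_le_abs_sub_int (S.pos i k n)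
    filter_upwards [eventually_mul_lt (2 * S.slopeBound + 1) hη] with ε hε z hz
    exact hε.trans_le (h z hz)
  have h6 : ∀ᶠ ε in 𝓝[>] (0 : ℝ), ∀ i k, ∀ n ∈ S.lines, ∀ z : ℤ,
      (2 * S.slopeBound + 1) * ε < |S.snap n (S.pos i k n) - z| := by
    simp only [eventually_all, eventually_all_finset]
    intro i k n _
    obtain ⟨η, hη, h⟩ := exists_pos_le_abs_sub_int (S.snap n (S.pos i k n))
    filter_upwards [eventually_mul_lt (2 * S.slopeBound + 1) hη] with ε hε z
    exact hε.trans_le (h z (S.snap_ne n _ z))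
  have h7 : ∀ᶠ ε in 𝓝[>] (0 : ℝ), ∀ i k, ∀ n ∈ S.lines, S.snap n (S.pos i k n) ≠ S.pos i k n →
      S.slopeBound * ε < |S.snap n (S.pos i k n) - S.pos i k n| := by
    simp only [eventually_all, eventually_all_finset]
    exact fun i k n _ h => eventually_mul_lt _ (abs_pos.2 (sub_ne_zero.2 h))
  filter_upwards [h1, h2, h3, h4, h5, h6, h7] with ε h1 h2 h3 h4 h5 h6 h7
  exact ⟨h1, h2, h3, h4, h5, h6, h7⟩

/-- Near the line `z k = n`, the other coordinate of the segment is near the crossing. -/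
lemma Crosses.abs_pt_rev_sub_le [Fintype ι] (h : S.Crosses i k n) (hw : |S.pt i t k - n| < ε) :
    |S.pt i t k.rev - S.pos i k n| ≤ S.slopeBound * ε := by
  rw [h.eq_pos_add t, add_sub_cancel_left, abs_mul]
  exact mul_le_mul abs_slope_le hw.le (abs_nonneg _) slopeBound_nonneg

lemma abs_sub_lt_of_far {u v n c : ℝ} {C ε : ℝ} (h1 : (2 * C + 1) * ε < |v - n|)
    (h2 : |u - v| ≤ C * ε) (hc : c ≤ C * ε + ε) : c < |u - n| := by
  have := abs_sub_abs_le_abs_sub (v - n) (v - u)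
  have h3 : v - n - (v - u) = u - n := by ring
  rw [h3, abs_sub_comm v u] at this
  linarith

/-- Near the crossing of the segment with `z k = n` there are no further grid lines, unless the
crossing is a corner. -/
lemma Fine.pos_eq [Fintype ι] (hε : S.Fine ε) (h : S.Crosses i k n) (hw : |S.pt i t k - n| < ε)
    (hw' : |S.pt i t k.rev - z| < ε) : S.pos i k n = z := by
  by_contra hz
  have := abs_sub_lt_of_far (hε.pos_far i k n h.mem_lines z hz) (h.abs_pt_rev_sub_le hw)
    (c := ε) (by nlinarith [slopeBound_nonneg (S := S), hε.pos])
  linarith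

/-! ### Each point is displaced by at most one line -/

lemma shift_of_not_active (h : ¬ S.Active i k n) : S.shift i k n = 0 := if_neg h

/-- Since `ε < 1 / 4`, strips of parallel lines are disjoint and one tent survives. -/
lemma disp_eq_of_abs_lt (hε0 : 0 < ε) (hε : ε < 1 / 4) {u : ℝ} (hu : |u - n| < ε) :
    S.disp ε i k u = S.shift i k n * tent ε (u - n) := by
  refine Finset.sum_eq_single n (fun m _ hm => ?_) fun hn => ?_
  · rw [tent_of_le_abs hε0, mul_zero]
    have h1 : (1 : ℝ) ≤ |(n : ℝ) - m| := by
      exact_mod_cast Int.one_le_abs (sub_ne_zero.2 hm.symm)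
    have h2 := abs_sub_le (n : ℝ) u m
    rw [abs_sub_comm (n : ℝ) u] at h2
    linarith
  · rw [shift_of_not_active fun h => hn h.1.mem_lines, zero_mul]

lemma disp_eq_zero (hε0 : 0 < ε) {u : ℝ} (hu : ∀ n : ℤ, |u - n| < ε → ¬ S.Active i k n) :
    S.disp ε i k u = 0 := by
  refine Finset.sum_eq_zero fun n _ => ?_
  by_cases h : |u - n| < ε
  · rw [shift_of_not_active (hu n h), zero_mul]
  · rw [tent_of_le_abs hε0 (not_lt.1 h), mul_zero]

/-- At most one grid line moves a given point of the segment. -/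
lemma Fine.not_active_rev [Fintype ι] (hε : S.Fine ε) (h : S.Active i k n)
    (hw : |S.pt i t k - n| < ε) (hw' : |S.pt i t k.rev - z| < ε) : ¬ S.Active i k.rev z := by
  intro h'
  have h1 := h.2 z (hε.pos_eq h.1 hw hw')
  have h2 := h'.2 n (hε.pos_eq h'.1 hw' (by rwa [Fin.rev_rev]))
  exact (S.beats_rev k n z).1 h2 h1

/-- The part of the moved curve `i` near `z k = n`, at parameter `t`. -/
structure Near (S : SnapData ι) (ε : ℝ) (i : ι) (t : ℝ) (k : Fin 2) (n : ℤ) : Prop where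
  active : S.Active i k n
  abs_lt : |S.pt i t k - n| < ε
  moved_eq : S.moved ε i t k = S.pt i t k
  moved_rev : S.moved ε i t k.rev =
    S.pt i t k.rev + S.shift i k n * tent ε (S.pt i t k - n)

/-- The dichotomy on which all later case distinctions rest: a point is displaced by exactly one
active line, or it is fixed and in the strip of no active line. -/
lemma near_or_eq [Fintype ι] (hε : S.Fine ε) (i : ι) (t : ℝ) :
    (∃ k n, S.Near ε i t k n) ∨
      (S.moved ε i t = S.pt i t ∧ ∀ k (n : ℤ), |S.pt i t k - n| < ε → ¬ S.Active i k n) := by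
  by_cases h : ∃ k, ∃ n : ℤ, S.Active i k n ∧ |S.pt i t k - n| < ε
  · obtain ⟨k, n, ha, hw⟩ := h
    refine Or.inl ⟨k, n, ha, hw, ?_, ?_⟩
    · rw [moved, disp_eq_zero hε.pos fun z hz => hε.not_active_rev ha hw hz, add_zero]
    · rw [moved, Fin.rev_rev, disp_eq_of_abs_lt hε.pos hε.lt hw]
  · push Not at h
    have h' : ∀ k (n : ℤ), |S.pt i t k - n| < ε → ¬ S.Active i k n :=
      fun k n hw ha => absurd (h k n ha) (not_le.2 hw)
    refine Or.inr ⟨?_, h'⟩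
    ext k
    rw [moved, disp_eq_zero hε.pos (h' _), add_zero]

/-- The convex combination form: order and distance statements valid for both the old and the new
crossing position pass to all intermediate ones. -/
lemma Near.rev_eq (h : S.Near ε i t k n) : S.moved ε i t k.rev =
    (1 - tent ε (S.pt i t k - n)) * S.pos i k n
      + tent ε (S.pt i t k - n) * S.snap n (S.pos i k n)
      + S.slope i k * (S.pt i t k - n) := by
  rw [h.moved_rev, h.active.1.eq_pos_add t, h.active.shift_eq]
  ring

lemma Near.abs_slope_mul_le [Fintype ι] (h : S.Near ε i t k n) :
    |S.slope i k * (S.pt i t k - n)| ≤ S.slopeBound * ε := by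
  rw [abs_mul]
  exact mul_le_mul abs_slope_le h.abs_lt.le (abs_nonneg _) slopeBound_nonneg

/-- Moved points stay away from the corners that belong to perpendicular lines. -/
lemma Near.far [Fintype ι] (hε : S.Fine ε) (h : S.Near ε i t k n) (hz : S.beats k.rev z n) :
    S.slopeBound * ε + ε < |S.moved ε i t k.rev - z| := by
  rw [S.beats_rev] at hz
  have hn := h.active.1.mem_lines
  have h1 : (z : ℝ) ∉ uIcc (S.pos i k n) (S.snap n (S.pos i k n)) :=
    fun h1 => hz (h.active.beats_of_mem h1)
  have h2 := hε.pos_far i k n hn z fun h2 => h1 (h2 ▸ left_mem_uIcc)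
  have h3 := hε.snap_far i k n hn z
  have h4 := abs_le.1 h.abs_slope_mul_le
  have ht0 := tent_nonneg ε (S.pt i t k - n)
  have ht1 := tent_le_one ε (S.pt i t k - n)
  rw [h.rev_eq]
  set p := S.pos i k n
  set q := S.snap n p
  set τ := tent ε (S.pt i t k - n)
  rw [mem_uIcc, not_or, not_and_or, not_and_or, not_le, not_le, not_le, not_le] at h1
  obtain ⟨h5, h6⟩ := h1
  -- The corner `z` is outside the range of the move, so old and new position are on the same side
  -- of it.
  have key : (z < p ∧ z < q) ∨ (p < z ∧ q < z) := by
    rcases h5 with h5 | h5 <;> rcases h6 with h6 | h6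
    · exact Or.inl ⟨h5, h6⟩
    · exact absurd h5 (not_lt.2 h6.le)
    · exact absurd h6 (not_lt.2 h5.le)
    · exact Or.inr ⟨h6, h5⟩
  rcases key with ⟨ha, hb⟩ | ⟨ha, hb⟩
  · rw [abs_of_pos (sub_pos.2 ha)] at h2
    rw [abs_of_pos (sub_pos.2 hb)] at h3
    refine lt_of_lt_of_le ?_ (le_abs_self _)
    have := lt_convex_combination h2 h3 ht0 ht1
    linarith
  · rw [abs_of_neg (sub_neg.2 ha)] at h2
    rw [abs_of_neg (sub_neg.2 hb)] at h3
    refine lt_of_lt_of_le ?_ (neg_le_abs _)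
    have := lt_convex_combination h2 h3 ht0 ht1
    linarith

/-! ### Moved curves do not meet where the segments did not -/

/-- One of the two lines owns their common corner. By `Near.far` the curve moved by the other line
stays more than `ε` away from the owner, while the curve moved by the owner is inside its strip. -/
lemma Near.not_near_rev [Fintype ι] (hε : S.Fine ε) (h : S.Near ε i t k n)
    (h' : S.Near ε j s k.rev z) (he : S.moved ε i t = S.moved ε j s) : False := by
  have hC := mul_nonneg (slopeBound_nonneg (S := S)) hε.pos.le
  by_cases hb : S.beats k n z
  · have h1 := h'.far hε (z := n) (by rwa [Fin.rev_rev])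
    rw [Fin.rev_rev, ← he, h.moved_eq] at h1
    linarith [h.abs_lt]
  · have h1 := h.far hε ((S.beats_rev k n z).2 hb)
    rw [he, h'.moved_eq] at h1
    linarith [h'.abs_lt]

/-- Moves along the line preserve the coordinate across it, so at a common point both curves have
the same tent value, and the separation of both old and new positions survives. -/
lemma Near.pos_le [Fintype ι] (hε : S.Fine ε) (h : S.Near ε i t k n)
    (h' : S.Near ε j s k n) (he : S.moved ε i t = S.moved ε j s) :
    S.pos j k n ≤ S.pos i k n := by
  by_contra! hlt
  have hn := h.active.1.mem_lines
  have h1 := hε.pos_sep i j k n hn hlt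
  have h2 := hε.snap_sep i j k n hn hlt
  have hu : S.pt i t k = S.pt j s k := by rw [← h.moved_eq, ← h'.moved_eq, he]
  have h3 := h.rev_eq
  have h4 := h'.rev_eq
  have h5 := abs_le.1 h.abs_slope_mul_le
  have h6 := abs_le.1 h'.abs_slope_mul_le
  have ht0 := tent_nonneg ε (S.pt i t k - n)
  have ht1 := tent_le_one ε (S.pt i t k - n)
  rw [he] at h3
  rw [← hu] at h4
  rw [h3] at h4
  rw [← hu] at h6
  have := lt_convex_combination h1 h2 ht0 ht1
  linarith

lemma Near.pt_eq [Fintype ι] (hε : S.Fine ε) (h : S.Near ε i t k n)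
    (h' : S.Near ε j s k n) (he : S.moved ε i t = S.moved ε j s) : S.pt i t = S.pt j s := by
  have hp : S.pos i k n = S.pos j k n := le_antisymm (h'.pos_le hε h he.symm) (h.pos_le hε h' he)
  have hu : S.pt i t k = S.pt j s k := by rw [← h.moved_eq, ← h'.moved_eq, he]
  have hv : S.pt i t k.rev = S.pt j s k.rev := by
    have h3 := h.moved_rev
    rw [he, h'.moved_rev, h.active.shift_eq, h'.active.shift_eq, hp, hu] at h3
    linarith
  ext l
  rcases eq_or_eq_rev k l with rfl | rfl <;> assumption

/-- A fixed point in the strip belongs to a segment that crosses the line at a corner owned by the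
perpendicular line. It is within `slopeBound * ε` of that corner along the line, whereas the moved
curve keeps a larger distance. -/
lemma Near.moved_ne_pt [Fintype ι] (hε : S.Fine ε) (hs : s ∈ Icc (0 : ℝ) 1)
    (h : S.Near ε i t k n)
    (h' : ∀ k (n : ℤ), |S.pt j s k - n| < ε → ¬ S.Active j k n) :
    S.moved ε i t ≠ S.pt j s := by
  intro he
  have hw : |S.pt j s k - n| < ε := by rw [← he, h.moved_eq]; exact h.abs_lt
  have hc : S.Crosses j k n := crosses_of_abs_lt hs (hw.trans hε.lt)
  have ha := h' k n hw
  simp only [Active, hc, true_and, not_forall] at ha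
  obtain ⟨z, hz, hb⟩ := ha
  have h1 := h.far hε ((S.beats_rev k n z).2 hb)
  have h2 := hc.abs_pt_rev_sub_le hw
  rw [he, ← hz] at h1
  linarith [hε.pos]

/-- Moving the segments does not create new intersections. -/
lemma Fine.pt_eq_of_moved_eq [Fintype ι] (hε : S.Fine ε) (ht : t ∈ Icc (0 : ℝ) 1)
    (hs : s ∈ Icc (0 : ℝ) 1) (he : S.moved ε i t = S.moved ε j s) : S.pt i t = S.pt j s := by
  rcases near_or_eq hε i t with ⟨k, n, h⟩ | ⟨h, h'⟩ <;>
    rcases near_or_eq hε j s with ⟨l, m, g⟩ | ⟨g, g'⟩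
  · rcases eq_or_eq_rev k l with rfl | rfl
    · have hnm : n = m := by
        by_contra hnm
        have h1 : (1 : ℝ) ≤ |(n : ℝ) - m| := by
          exact_mod_cast Int.one_le_abs (sub_ne_zero.2 hnm)
        have h2 := abs_sub_le (n : ℝ) (S.pt i t l) m
        have h3 := h.abs_lt
        have h4 := g.abs_lt
        rw [← g.moved_eq, ← he, h.moved_eq] at h4
        rw [abs_sub_comm (n : ℝ) (S.pt i t l)] at h2
        linarith [hε.lt]
      subst hnm
      exact h.pt_eq hε g he
    · exact (h.not_near_rev hε g he).elim
  · exact (h.moved_ne_pt hε hs g' (he.trans g)).elim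
  · exact (g.moved_ne_pt hε ht h' (he.symm.trans h)).elim
  · rw [← h, ← g, he]

/-! ### Endpoints, and the points of the moved curves on grid lines -/

lemma Fine.moved_eq_pt_of_far [Fintype ι] (hε : S.Fine ε)
    (h : ∀ k, ∀ n ∈ S.lines, ε ≤ |S.pt i t k - n| ) : S.moved ε i t = S.pt i t := by
  rcases near_or_eq hε i t with ⟨k, n, h'⟩ | ⟨h', -⟩
  · exact absurd (h k n h'.active.1.mem_lines) (not_le.2 h'.abs_lt)
  · exact h'

lemma Fine.moved_zero [Fintype ι] (hε : S.Fine ε) : S.moved ε i 0 = S.pt i 0 :=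
  hε.moved_eq_pt_of_far fun k n _ => by
    simpa [pt] using hε.lt.le.trans (S.start_far i k n)

lemma Fine.moved_one [Fintype ι] (hε : S.Fine ε) : S.moved ε i 1 = S.pt i 1 :=
  hε.moved_eq_pt_of_far fun k n _ => by
    simpa [pt] using hε.lt.le.trans (S.stop_far i k n)

/-- A moved curve that differs from the segment is near a grid line. -/
lemma Fine.moved_eq_pt_or [Fintype ι] (hε : S.Fine ε) (i : ι) (t : ℝ) :
    S.moved ε i t = S.pt i t ∨ ∃ k, ∃ n ∈ S.lines,
      |S.pt i t k - n| < ε ∧ S.moved ε i t k = S.pt i t k := by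
  rcases near_or_eq hε i t with ⟨k, n, h'⟩ | ⟨h', -⟩
  · exact Or.inr ⟨k, n, h'.active.1.mem_lines, h'.abs_lt, h'.moved_eq⟩
  · exact Or.inl h'

/-- The points of a moved curve on a grid line are snapped crossings with this line or lie near a
corner that belongs to the perpendicular line. -/
lemma Fine.on_line [Fintype ι] (hε : S.Fine ε) (ht : t ∈ Icc (0 : ℝ) 1)
    (h : S.moved ε i t k = n) :
    (S.Near ε i t k n ∧ S.moved ε i t k.rev = S.snap n (S.pos i k n)) ∨
    ∃ z : ℤ, S.Near ε i t k.rev z ∧ S.beats k.rev z n ∧ |S.moved ε i t k.rev - z| < ε ∧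
      S.moved ε i t k.rev ≠ z := by
  rcases near_or_eq hε i t with ⟨l, m, h'⟩ | ⟨h', ha⟩
  · rcases eq_or_eq_rev k l with rfl | rfl
    · have hm : m = n := by
        by_contra hm
        have h1 : (1 : ℝ) ≤ |(n : ℝ) - m| := by
          exact_mod_cast Int.one_le_abs (sub_ne_zero.2 (Ne.symm hm))
        have h2 := h'.abs_lt
        rw [← h'.moved_eq, h] at h2
        linarith [hε.lt]
      subst hm
      refine Or.inl ⟨h', ?_⟩
      have hu : S.pt i t l - m = 0 := by rw [← h'.moved_eq, h, sub_self]
      rw [h'.rev_eq, hu, tent_zero]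
      ring
    · have h1 := h'.moved_eq
      refine Or.inr ⟨m, h', ?_, ?_, ?_⟩
      · by_contra hb
        have h2 := h'.far hε (z := n) (by
          rw [Fin.rev_rev]
          rw [S.beats_rev, not_not] at hb
          exact hb)
        rw [Fin.rev_rev, h, sub_self, abs_zero] at h2
        linarith [mul_nonneg (slopeBound_nonneg (S := S)) hε.pos.le, hε.pos]
      · rw [h1]; exact h'.abs_lt
      · intro h2
        have h3 := h'.rev_eq
        rw [h1] at h2
        rw [Fin.rev_rev, h, h2, sub_self, tent_zero] at h3
        exact S.snap_ne m (S.pos i k.rev m) n (by linarith)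
  -- A fixed point on a line would be a corner owned by the perpendicular line; but then that line
  -- is active there.
  · exfalso
    rw [h'] at h
    have hw : |S.pt i t k - n| < ε := by rw [h, sub_self, abs_zero]; exact hε.pos
    have hc : S.Crosses i k n := crosses_of_abs_lt ht (hw.trans hε.lt)
    have hna := ha k n hw
    simp only [Active, hc, true_and, not_forall] at hna
    obtain ⟨z, hz, hb⟩ := hna
    obtain ⟨hc', hp⟩ := crosses_rev_of_pos_eq hc hz
    have hw' : |S.pt i t k.rev - z| < ε := by
      rw [hc.eq_pos_add t, hz, h, sub_self, mul_zero, add_zero, sub_self, abs_zero]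
      exact hε.pos
    refine ha k.rev z hw' ⟨hc', fun y hy => ?_⟩
    rw [hp] at hy
    rw [← Int.cast_injective hy]
    exact (S.beats_rev k n z).2 hb

lemma Crosses.eq_of_pt_eq (h : S.Crosses i k n) {s t : ℝ} (he : S.pt i s k = S.pt i t k) :
    s = t := by
  have : s * S.dir i k = t * S.dir i k := by simpa [pt] using he
  exact mul_right_cancel₀ h.dir_ne_zero this

/-- On either side of a grid line, the moved curve meets a perpendicular line at most once. -/
lemma Near.eq_of_rev_eq [Fintype ι] (hε : S.Fine ε) (hs : S.Near ε i s k n)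
    (ht : S.Near ε i t k n) (hs' : S.moved ε i s k.rev = z) (ht' : S.moved ε i t k.rev = z)
    (hside : n ≤ S.pt i s k ↔ n ≤ S.pt i t k) : s = t := by
  refine hs.active.1.eq_of_pt_eq ?_
  have hn := hs.active.1.mem_lines
  have h1 := hs.rev_eq
  have h2 := ht.rev_eq
  rw [tent_of_abs_le hε.pos hs.abs_lt.le, hs'] at h1
  rw [tent_of_abs_le hε.pos ht.abs_lt.le, ht'] at h2
  have hne := S.snap_ne n (S.pos i k n) z
  have hl := hε.shift_large i k n hn
  have hsl := mul_le_mul_of_nonneg_right (abs_slope_le (S := S) (i := i) (k := k)) hε.pos.le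
  have h0 := hε.pos
  set p := S.pos i k n
  set q := S.snap n p
  set α := S.slope i k
  obtain ⟨σ, hσ, h3, h4⟩ : ∃ σ : ℝ, (σ = 1 ∨ σ = -1) ∧
      |S.pt i s k - n| = σ * (S.pt i s k - n) ∧ |S.pt i t k - n| = σ * (S.pt i t k - n) := by
    by_cases h : n ≤ S.pt i s k
    · refine ⟨1, Or.inl rfl, ?_, ?_⟩ <;> rw [one_mul, abs_of_nonneg]
      · linarith
      · linarith [hside.1 h]
    · refine ⟨-1, Or.inr rfl, ?_, ?_⟩ <;> rw [neg_one_mul, abs_of_neg]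
      · linarith [not_le.1 h]
      · linarith [not_le.1 (mt hside.2 h)]
  rw [h3] at h1
  rw [h4] at h2
  -- On one side of the line the moved coordinate is affine. If it were constant, either `q = p` and
  -- `α = 0`, so that it equals the non-integer `q`, or `|α| * ε = |q - p|`, against `shift_large`.
  have h5 : (α * ε - σ * (q - p)) * (S.pt i s k - S.pt i t k) = 0 := by
    field_simp at h1 h2
    linear_combination h2 - h1
  rcases mul_eq_zero.1 h5 with h6 | h6
  · by_cases hqp : q = p
    · exfalso
      have hα : α = 0 := by
        rw [hqp, sub_self, mul_zero, sub_zero] at h6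
        exact (mul_eq_zero.1 h6).resolve_right h0.ne'
      rw [hqp, hα] at h1
      apply hne
      rw [hqp, h1]
      ring
    · exfalso
      have h7 := hl hqp
      have h8 : |α| * ε = |q - p| := by
        have h9 : α * ε = σ * (q - p) := by linarith
        have h10 := abs_mul α ε
        rw [abs_of_pos h0, h9, abs_mul] at h10
        rw [← h10]
        rcases hσ with rfl | rfl <;> simp
      linarith
  · linarith

/-- The moved curves meet the grid only finitely often. -/
lemma Fine.finite_times [Fintype ι] (hε : S.Fine ε) (i : ι) (T : Finset ℤ) :
    {t ∈ Icc (0 : ℝ) 1 | ∃ k, ∃ n ∈ T, S.moved ε i t k = n}.Finite := by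
  let A (k : Fin 2) (n : ℤ) : Set ℝ := {t | S.Near ε i t k n ∧ S.moved ε i t k = n}
  let B (k : Fin 2) (n z : ℤ) : Set ℝ :=
    {t | S.Near ε i t k.rev z ∧ S.moved ε i t k = n ∧ z ≤ S.pt i t k.rev}
  let C (k : Fin 2) (n z : ℤ) : Set ℝ :=
    {t | S.Near ε i t k.rev z ∧ S.moved ε i t k = n ∧ ¬ z ≤ S.pt i t k.rev}
  have hA : ∀ k n, (A k n).Finite := fun k n => by
    refine Subsingleton.finite fun s hs t ht => hs.1.active.1.eq_of_pt_eq ?_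
    rw [← hs.1.moved_eq, ← ht.1.moved_eq, hs.2, ht.2]
  have hB : ∀ k n z, (B k n z).Finite := fun k n z => by
    refine Subsingleton.finite fun s hs t ht =>
      hs.1.eq_of_rev_eq hε ht.1 (z := n) ?_ ?_ (iff_of_true hs.2.2 ht.2.2)
    · rw [Fin.rev_rev]; exact hs.2.1
    · rw [Fin.rev_rev]; exact ht.2.1
  have hC : ∀ k n z, (C k n z).Finite := fun k n z => by
    refine Subsingleton.finite fun s hs t ht =>
      hs.1.eq_of_rev_eq hε ht.1 (z := n) ?_ ?_ (iff_of_false hs.2.2 ht.2.2)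
    · rw [Fin.rev_rev]; exact hs.2.1
    · rw [Fin.rev_rev]; exact ht.2.1
  have hfin : (⋃ k, ⋃ n ∈ T, (A k n ∪ ⋃ z ∈ S.lines, (B k n z ∪ C k n z))).Finite :=
    finite_iUnion fun k => T.finite_toSet.biUnion fun n _ => (hA k n).union
      (S.lines.finite_toSet.biUnion fun z _ => (hB k n z).union (hC k n z))
  refine hfin.subset ?_
  rintro t ⟨ht, k, n, hn, h⟩
  simp only [mem_iUnion]
  refine ⟨k, n, hn, ?_⟩
  rcases hε.on_line ht h with ⟨h1, -⟩ | ⟨z, h1, -⟩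
  · exact Or.inl ⟨h1, h⟩
  · refine Or.inr ?_
    simp only [mem_iUnion]
    refine ⟨z, h1.active.1.mem_lines, ?_⟩
    by_cases hz : z ≤ S.pt i t k.rev
    · exact Or.inl ⟨h1, h, hz⟩
    · exact Or.inr ⟨h1, h, hz⟩

lemma continuous_moved (i : ι) (k : Fin 2) : Continuous fun t => S.moved ε i t k := by
  have h : ∀ k, Continuous fun t => S.pt i t k := fun k => by unfold pt; fun_prop
  refine (h k).add ?_
  unfold disp
  refine continuous_finsetSum _ fun n _ => continuous_const.mul ?_
  exact (continuous_tent ε).comp ((h _).sub continuous_const)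

end SnapData

/-! ### Lengths of the moved curves -/

lemma eVariationOn_le_of_dist_le {E : Type*} [PseudoMetricSpace E] {f : unitInterval → E}
    {V : ℝ → ℝ} (h : ∀ s t : unitInterval, s ≤ t → dist (f s) (f t) ≤ V t - V s) :
    eVariationOn f univ ≤ ENNReal.ofReal (V 1 - V 0) := by
  have hV : Monotone fun t : unitInterval => V t := fun s t hst => by
    have := dist_nonneg.trans (h s t hst)
    linarith
  have h1 : eVariationOn f univ ≤ eVariationOn (fun t : unitInterval => V t) univ := by
    refine iSup_mono fun p => Finset.sum_le_sum fun i _ => ?_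
    have hp : p.2.1 i ≤ p.2.1 (i + 1) := p.2.2.1 (Nat.le_succ i)
    rw [edist_dist, edist_dist]
    refine ENNReal.ofReal_le_ofReal ?_
    rw [dist_comm, Real.dist_eq]
    exact (h _ _ hp).trans (le_abs_self _)
  refine h1.trans ?_
  have h2 := (hV.monotoneOn univ).eVariationOn_eq (mem_univ 0) (mem_univ 1)
  have h3 : univ ∩ Icc (0 : unitInterval) 1 = univ := by
    ext t; simp only [mem_inter_iff, mem_univ, true_and, iff_true]; exact ⟨t.2.1, t.2.2⟩
  rw [h3] at h2
  exact h2.le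

lemma norm_le_sum_abs (v : Plane) : ‖v‖ ≤ ∑ k, |v k| := by
  rw [EuclideanSpace.norm_eq, Fin.sum_univ_two, Fin.sum_univ_two, Real.norm_eq_abs,
    Real.norm_eq_abs, Real.sqrt_le_left (by positivity)]
  nlinarith [abs_nonneg (v 0), abs_nonneg (v 1)]

lemma sum_abs_le_norm (v : Plane) : ∑ k, |v k| ≤ Real.sqrt 2 * ‖v‖ := by
  rw [EuclideanSpace.norm_eq, Fin.sum_univ_two, Fin.sum_univ_two, Real.norm_eq_abs,
    Real.norm_eq_abs, ← Real.sqrt_mul (by norm_num)]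
  refine Real.le_sqrt_of_sq_le ?_
  nlinarith [sq_nonneg (|v 0| - |v 1|)]

/-- The clamp function whose absolute value is the complement of `tent`. -/
noncomputable def clamp (ε u : ℝ) : ℝ := max (-1) (min 1 (u / ε))

lemma clamp_mono {ε : ℝ} (hε : 0 < ε) : Monotone (clamp ε) := fun u v h => by
  unfold clamp
  gcongr

lemma abs_clamp_le (ε u : ℝ) : |clamp ε u| ≤ 1 :=
  abs_le.2 ⟨le_max_left _ _, max_le (by norm_num) (min_le_left _ _)⟩

/-- By the reverse triangle inequality a tent varies no more than the monotone clamp, whose total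
variation is at most 2; this is the factor 2 in the length bound. -/
lemma abs_tent_sub_le (ε u v : ℝ) : |tent ε u - tent ε v| ≤ |clamp ε u - clamp ε v| := by
  have h := abs_abs_sub_abs_le_abs_sub (clamp ε v) (clamp ε u)
  rw [abs_sub_comm (clamp ε u)]
  refine le_trans (le_of_eq ?_) h
  unfold tent clamp
  congr 1
  ring

namespace SnapData

variable {ι : Type*} {S : SnapData ι} {ε : ℝ} {i : ι} {k : Fin 2} {n : ℤ} {s t : ℝ}

variable (S) in
/-- The total variation of a tent along a segment, up to a parameter. -/
noncomputable def tentVar (ε : ℝ) (i : ι) (k : Fin 2) (n : ℤ) (t : ℝ) : ℝ :=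
  if 0 ≤ S.dir i k then clamp ε (S.pt i t k - n) else -clamp ε (S.pt i t k - n)

lemma abs_tent_sub_le_tentVar (hε : 0 < ε) (hst : s ≤ t) :
    |tent ε (S.pt i s k - n) - tent ε (S.pt i t k - n)| ≤
      S.tentVar ε i k n t - S.tentVar ε i k n s := by
  refine (abs_tent_sub_le _ _ _).trans ?_
  unfold tentVar
  split_ifs with h
  · have h1 : S.pt i s k - n ≤ S.pt i t k - n := by unfold pt; nlinarith
    rw [abs_of_nonpos (sub_nonpos.2 (clamp_mono hε h1))]
    linarith
  · have h1 : S.pt i t k - n ≤ S.pt i s k - n := by unfold pt; nlinarith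
    rw [abs_of_nonneg (sub_nonneg.2 (clamp_mono hε h1))]
    linarith

lemma tentVar_sub_le : S.tentVar ε i k n t - S.tentVar ε i k n s ≤ 2 := by
  have h1 := abs_le.1 (abs_clamp_le ε (S.pt i t k - n))
  have h2 := abs_le.1 (abs_clamp_le ε (S.pt i s k - n))
  unfold tentVar
  split_ifs <;> linarith

lemma abs_disp_sub_le (hε : 0 < ε) (hst : s ≤ t) :
    |S.disp ε i k (S.pt i s k) - S.disp ε i k (S.pt i t k)| ≤
      ∑ n ∈ S.lines, |S.shift i k n| * (S.tentVar ε i k n t - S.tentVar ε i k n s) := by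
  unfold disp
  rw [← Finset.sum_sub_distrib]
  refine (Finset.abs_sum_le_sum_abs _ _).trans (Finset.sum_le_sum fun n _ => ?_)
  rw [← mul_sub, abs_mul]
  exact mul_le_mul_of_nonneg_left (abs_tent_sub_le_tentVar hε hst) (abs_nonneg _)

/-- The length of a moved curve exceeds that of the segment by at most twice the moves. -/
lemma eVariationOn_moved_le (hε : 0 < ε) {d : Plane} (hd : ∀ k, S.dir i k = d k) (o : Fin 2 → ℝ)
    {f : unitInterval → Plane} (hf : ∀ t k, f t k = S.moved ε i t k + o k) :
    eVariationOn f univ ≤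
      ENNReal.ofReal (‖d‖ + ∑ k, ∑ n ∈ S.lines, 2 * |S.shift i k n|) := by
  -- A monotone majorant of arc length: the length of the segment plus the variation of all tents.
  -- It bounds the total independently of `ε`.
  let V (t : ℝ) : ℝ := t * ‖d‖ + ∑ k, ∑ n ∈ S.lines, |S.shift i k n| * S.tentVar ε i k n t
  have hVsub : ∀ s t, V t - V s = (t - s) * ‖d‖ +
      ∑ k, ∑ n ∈ S.lines, |S.shift i k n| * (S.tentVar ε i k n t - S.tentVar ε i k n s) := by
    intro s t
    simp only [V, mul_sub, Finset.sum_sub_distrib]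
    ring
  refine (eVariationOn_le_of_dist_le (V := V) fun s t hst => ?_).trans
    (ENNReal.ofReal_le_ofReal ?_)
  · have hst' : (s : ℝ) ≤ t := hst
    rw [hVsub, dist_comm, dist_eq_norm]
    have h1 : f t - f s = ((t : ℝ) - s) • d + (f t - f s - ((t : ℝ) - s) • d) := by abel
    rw [h1]
    refine (norm_add_le _ _).trans (add_le_add ?_ ?_)
    · rw [norm_smul, Real.norm_of_nonneg (sub_nonneg.2 hst')]
    · refine (norm_le_sum_abs _).trans ?_
      have h2 : ∀ k, |(f t - f s - ((t : ℝ) - s) • d) k| =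
          |S.disp ε i k.rev (S.pt i s k.rev) - S.disp ε i k.rev (S.pt i t k.rev)| := by
        intro k
        rw [abs_sub_comm]
        simp only [PiLp.sub_apply, PiLp.smul_apply, smul_eq_mul, hf, moved, ← hd]
        congr 1
        simp only [pt]
        ring
      have h3 := Equiv.sum_comp Fin.revPerm fun k =>
        |S.disp ε i k (S.pt i s k) - S.disp ε i k (S.pt i t k)|
      simp only [Fin.revPerm_apply] at h3
      rw [Finset.sum_congr rfl fun k _ => h2 k, h3]
      exact Finset.sum_le_sum fun k _ => abs_disp_sub_le hε hst'
  · rw [hVsub, sub_zero, one_mul]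
    refine add_le_add le_rfl (Finset.sum_le_sum fun k _ => Finset.sum_le_sum fun n _ => ?_)
    rw [mul_comm]
    exact mul_le_mul_of_nonneg_right tentVar_sub_le (abs_nonneg _)

end SnapData

/-! ### Snapping segments between points near the lattice -/

/-- The components of the random shift. -/
def offset {L : ℕ} (a : Fin L × Fin L) : Fin 2 → Fin L := ![a.1, a.2]

lemma corner_eq {L : ℕ} (a : Fin L × Fin L) (k : Fin 2) :
    corner a k = -(offset a k : ℝ) - 1 / 2 := by
  fin_cases k <;> rfl

lemma exists_abs_sub_lt {L : ℕ} {x : Plane} (hx : x ∈ Metric.thickening (1 / 4) (lattice L))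
    (k : Fin 2) : ∃ j : ℕ, j ≤ L ∧ |x k - j| < 1 / 4 := by
  obtain ⟨z, ⟨i, j, hi, hj, rfl⟩, hd⟩ := Metric.mem_thickening_iff.1 hx
  have h := fun k => (PiLp.norm_apply_le (x - !₂[(i : ℝ), (j : ℝ)]) k).trans_lt
    (by rwa [← dist_eq_norm])
  match k with
  | 0 => exact ⟨i, hi, by simpa using h 0⟩
  | 1 => exact ⟨j, hj, by simpa using h 1⟩

/-- Grid lines sit at half-integers, at distance at least `1 / 2` from lattice coordinates. -/
lemma far_of_near_lattice {L : ℕ} {x : Plane} (hx : x ∈ Metric.thickening (1 / 4) (lattice L))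
    (a : Fin L × Fin L) (k : Fin 2) (n : ℤ) : 1 / 4 ≤ |x k - corner a k - n| := by
  obtain ⟨j, -, hj⟩ := exists_abs_sub_lt hx k
  rw [corner_eq]
  obtain ⟨h1, h2⟩ := abs_lt.1 hj
  have h3 : (j : ℤ) + offset a k - n ≤ -1 ∨ 0 ≤ (j : ℤ) + offset a k - n := by omega
  rcases h3 with h3 | h3
  · have h4 : (j : ℝ) + offset a k - n ≤ -1 := by exact_mod_cast h3
    exact le_trans (by linarith) (neg_le_abs _)
  · have h4 : 0 ≤ (j : ℝ) + offset a k - n := by exact_mod_cast h3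
    exact le_trans (by linarith) (le_abs_self _)

lemma between_of_div_mem {u v c : ℝ} (h0 : 0 < (c - u) / (v - u)) (h1 : (c - u) / (v - u) < 1) :
    (u < c ∧ c < v) ∨ (v < c ∧ c < u) := by
  rcases lt_trichotomy u v with h | h | h
  · rw [div_lt_one (sub_pos.2 h)] at h1
    have := (div_pos_iff_of_pos_right (sub_pos.2 h)).1 h0
    exact Or.inl ⟨by linarith, by linarith⟩
  · simp [h] at h0
  · rw [div_lt_one_of_neg (sub_neg.2 h)] at h1
    rcases div_pos_iff.1 h0 with h2 | h2
    · linarith [h2.2]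
    · exact Or.inr ⟨by linarith, by linarith [h2.1]⟩

/-- The segment from `x` to `y` crosses the line `z k = P - 1 / 2`. -/
def CrossesAt (x y : Plane) (k : Fin 2) (P : ℤ) : Prop :=
  0 < (P - 1 / 2 - x k) / (y k - x k) ∧ (P - 1 / 2 - x k) / (y k - x k) < 1

section

variable {L : ℕ} {x y : Plane} {k : Fin 2} {P : ℤ}

lemma CrossesAt.mem_Icc (h : CrossesAt x y k P)
    (hx : x ∈ Metric.thickening (1 / 4) (lattice L))
    (hy : y ∈ Metric.thickening (1 / 4) (lattice L)) : P ∈ Finset.Icc 1 (L : ℤ) := by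
  obtain ⟨i, hi, hxi⟩ := exists_abs_sub_lt hx k
  obtain ⟨j, hj, hyj⟩ := exists_abs_sub_lt hy k
  have hi' : (i : ℝ) ≤ L := by exact_mod_cast hi
  have hj' : (j : ℝ) ≤ L := by exact_mod_cast hj
  have hi0 : (0 : ℝ) ≤ i := i.cast_nonneg
  have hj0 : (0 : ℝ) ≤ j := j.cast_nonneg
  obtain ⟨h1, h2⟩ := abs_lt.1 hxi
  obtain ⟨h3, h4⟩ := abs_lt.1 hyj
  have h5 : (0 : ℝ) < P ∧ (P : ℝ) < L + 1 := by
    rcases between_of_div_mem h.1 h.2 with h | h <;> constructor <;> linarith [h.1, h.2]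
  rw [Finset.mem_Icc]
  have h6 : 0 < P := by exact_mod_cast h5.1
  have h7 : P < L + 1 := by exact_mod_cast h5.2
  omega

open Classical in
/-- The grid lines that are crossed by the segment from `x` to `y`. -/
noncomputable def crossings (L : ℕ) (x y : Plane) (k : Fin 2) : Finset ℤ :=
  (Finset.Icc 1 (L : ℤ)).filter (CrossesAt x y k)

lemma mem_crossings : P ∈ crossings L x y k ↔ P ∈ Finset.Icc 1 (L : ℤ) ∧ CrossesAt x y k P := by
  classical
  rw [crossings, Finset.mem_filter]

/-- With lattice coordinates `i`, `j` near the endpoints there are at most `|i - j|` crossings, and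
`|i - j|` exceeds the coordinate difference by at most `1 / 2`. If `i ≠ j`, that difference is at
least `1 / 2`, so doubling it absorbs the excess; if `i = j`, nothing is crossed. -/
lemma card_crossings_le (hx : x ∈ Metric.thickening (1 / 4) (lattice L))
    (hy : y ∈ Metric.thickening (1 / 4) (lattice L)) :
    ((crossings L x y k).card : ℝ) ≤ 2 * |(y - x) k| := by
  obtain ⟨i, hi, hxi⟩ := exists_abs_sub_lt hx k
  obtain ⟨j, hj, hyj⟩ := exists_abs_sub_lt hy k
  obtain ⟨h1, h2⟩ := abs_lt.1 hxi
  obtain ⟨h3, h4⟩ := abs_lt.1 hyj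
  have hsub : crossings L x y k ⊆ Finset.Ioc (min i j : ℤ) (max i j) := by
    intro P hP
    obtain ⟨-, hP⟩ := mem_crossings.1 hP
    rw [Finset.mem_Ioc, min_lt_iff, le_max_iff]
    rcases between_of_div_mem hP.1 hP.2 with ⟨h5, h6⟩ | ⟨h5, h6⟩
    · have h7 : (i : ℝ) < P := by linarith
      have h8 : (P : ℝ) < j + 1 := by linarith
      norm_cast at h7 h8
      omega
    · have h7 : (j : ℝ) < P := by linarith
      have h8 : (P : ℝ) < i + 1 := by linarith
      norm_cast at h7 h8
      omega
  have hcard := Finset.card_le_card hsub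
  have hcard' : (crossings L x y k).card ≤ ((i : ℤ) - j).natAbs := by
    rw [Int.card_Ioc] at hcard
    omega
  have hcard2 : ((crossings L x y k).card : ℝ) ≤ |(i : ℝ) - j| := by
    have : ((crossings L x y k).card : ℤ) ≤ |(i : ℤ) - j| := by
      rw [Int.abs_eq_natAbs]; exact_mod_cast hcard'
    exact_mod_cast this
  refine hcard2.trans ?_
  rw [PiLp.sub_apply]
  rcases eq_or_ne i j with rfl | hij
  · simp
  · have h5 : (1 : ℝ) ≤ |(i : ℝ) - j| := by
      have : (1 : ℤ) ≤ |(i : ℤ) - j| := Int.one_le_abs (by omega)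
      exact_mod_cast this
    have h6 : |(i : ℝ) - j| - |y k - x k| ≤ 1 / 2 := by
      rw [abs_sub_comm (i : ℝ)]
      refine (abs_sub_abs_le_abs_sub _ _).trans (abs_le.2 ⟨?_, ?_⟩) <;> linarith
    linarith

end

section

variable {ι : Type*} {L : ℕ} {x y : ι → Plane}

/-- The data for snapping a family of segments to the portals of the dissection `D(a)`. -/
noncomputable def segmentSnap (hL : ∃ e : ℕ, L = 2 ^ e)
    (hx : ∀ i, x i ∈ Metric.thickening (1 / 4) (lattice L))
    (hy : ∀ i, y i ∈ Metric.thickening (1 / 4) (lattice L)) {M : ℕ} (hM : 0 < M) {θ : ℝ}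
    (hθ : 0 < θ) (hθM : θ * M < 1) (a : Fin L × Fin L) : SnapData ι :=
  have hθ1 : θ < 1 := by
    have : (1 : ℝ) ≤ M := by exact_mod_cast hM
    nlinarith
  have hL0 : 0 < L := by
    obtain ⟨e, rfl⟩ := hL
    positivity
  { start := fun i k => x i k - corner a k
    dir := fun i k => (y i - x i) k
    snap := fun n => snapMap (cell L n) M θ
    beats := cellBeats L
    lines := Finset.Ioo 0 (2 * L)
    start_far := fun i k n => far_of_near_lattice (hx i) a k n
    stop_far := fun i k n => by
      have := far_of_near_lattice (hy i) a k n
      rw [PiLp.sub_apply]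
      convert this using 2
      ring
    mem_lines := fun i k n h0 h1 => by
      have h : CrossesAt (x i) (y i) k (n - offset a k) := by
        rw [PiLp.sub_apply, corner_eq] at h0 h1
        unfold CrossesAt
        push_cast
        refine ⟨?_, ?_⟩
        · convert h0 using 2; ring
        · convert h1 using 2; ring
      have h2 := Finset.mem_Icc.1 (h.mem_Icc (hx i) (hy i))
      have := (offset a k).2
      rw [Finset.mem_Ioo]
      omega
    beats_rev := fun k n n' => cellBeats_rev k
    snap_strictMono := fun n => snapMap_strictMono (cell_pos hL0) hM hθ hθ1
    snap_ne := fun n v z => snapMap_ne_int hM hθ hθM z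
    beats_of_mem := fun n k v z hz hne => cellBeats_of_not_dvd hL
      (not_dvd_of_mem_uIcc_snapMap (cell_pos hL0) hM hθ hθ1 hz hne) }

variable {hL : ∃ e : ℕ, L = 2 ^ e} {hx : ∀ i, x i ∈ Metric.thickening (1 / 4) (lattice L)}
  {hy : ∀ i, y i ∈ Metric.thickening (1 / 4) (lattice L)} {M : ℕ} {hM : 0 < M} {θ : ℝ}
  {hθ : 0 < θ} {hθM : θ * M < 1} {a : Fin L × Fin L} {i : ι} {k : Fin 2}

lemma crosses_segmentSnap {n : ℤ} : (segmentSnap hL hx hy hM hθ hθM a).Crosses i k n ↔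
    CrossesAt (x i) (y i) k (n - offset a k) := by
  have h : (segmentSnap hL hx hy hM hθ hθM a).time i k n =
      (((n - offset a k : ℤ) : ℝ) - 1 / 2 - x i k) / (y i k - x i k) := by
    change (n - (x i k - corner a k)) / (y i - x i) k = _
    rw [PiLp.sub_apply, corner_eq]
    push_cast
    congr 1
    ring
  unfold SnapData.Crosses CrossesAt
  rw [h]

lemma abs_shift_segmentSnap_le {n : ℤ} :
    2 * |(segmentSnap hL hx hy hM hθ hθM a).shift i k n| ≤ cell L n / M + 2 * θ := by
  have hL0 : 0 < L := by
    obtain ⟨e, rfl⟩ := id hL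
    positivity
  have hM' : (0 : ℝ) < M := by positivity
  unfold SnapData.shift
  split_ifs
  · have h := abs_snapMap_sub_le (v := (segmentSnap hL hx hy hM hθ hθM a).pos i k n)
      (cell_pos (n := n) hL0) hM hθ
    have h2 : (cell L n : ℝ) / (2 * M) = cell L n / M / 2 := by field_simp
    rw [h2] at h
    change 2 * |snapMap (cell L n) M θ _ - _| ≤ _
    linarith
  · rw [abs_zero, mul_zero]
    positivity

/-- Substituting `n = P + offset a k` makes the index set independent of `a`, so the expectation can
be taken crossing by crossing. -/
lemma sum_shift_segmentSnap_le :
    ∑ n ∈ (segmentSnap hL hx hy hM hθ hθM a).lines,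
      2 * |(segmentSnap hL hx hy hM hθ hθM a).shift i k n| ≤
    ∑ P ∈ crossings L (x i) (y i) k, ((cell L (P + offset a k) : ℝ) / M + 2 * θ) := by
  have hM' : (0 : ℝ) < M := by positivity
  have hsub : (crossings L (x i) (y i) k).image (fun P => P + (offset a k : ℤ)) ⊆
      (segmentSnap hL hx hy hM hθ hθM a).lines := by
    intro n hn
    obtain ⟨P, hP, rfl⟩ := Finset.mem_image.1 hn
    have h1 := Finset.mem_Icc.1 (mem_crossings.1 hP).1
    have h2 := (offset a k).2
    change _ ∈ Finset.Ioo (0 : ℤ) (2 * L)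
    rw [Finset.mem_Ioo]
    omega
  rw [← Finset.sum_subset hsub, Finset.sum_image (by simp)]
  · exact Finset.sum_le_sum fun P _ => abs_shift_segmentSnap_le
  · intro n _ hn
    rw [SnapData.shift_of_not_active, abs_zero, mul_zero]
    intro h
    have h1 := crosses_segmentSnap.1 h.1
    exact hn (Finset.mem_image.2 ⟨n - offset a k,
      mem_crossings.2 ⟨h1.mem_Icc (hx i) (hy i), h1⟩, by ring⟩)

end

/-! ### The expected increase of the length -/

lemma sum_offset {L : ℕ} (k : Fin 2) (f : Fin L → ℝ) :
    ∑ a : Fin L × Fin L, f (offset a k) = L * ∑ b, f b := by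
  rw [Fintype.sum_prod_type]
  match k with
  | 0 => simp [offset, Finset.mul_sum]
  | 1 => simp [offset]

lemma sum_sum_crossings_le {L e : ℕ} (hL : L = 2 ^ e) {x y : Plane}
    (hx : x ∈ Metric.thickening (1 / 4) (lattice L))
    (hy : y ∈ Metric.thickening (1 / 4) (lattice L)) {M : ℕ} {θ : ℝ} (hθ : 0 < θ) :
    ∑ a : Fin L × Fin L, ∑ k, ∑ P ∈ crossings L x y k,
      ((cell L (P + offset a k) : ℝ) / M + 2 * θ) ≤
    L ^ 2 * ((e + 2) / (2 * M) + 2 * θ) * (2 * Real.sqrt 2 * dist x y) := by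
  have h1 : ∀ k, ∀ P : ℤ, ∑ a : Fin L × Fin L, ((cell L (P + offset a k) : ℝ) / M + 2 * θ) =
      L ^ 2 * ((e + 2) / (2 * M) + 2 * θ) := by
    intro k P
    rw [sum_offset k fun b => ((cell L (P + b) : ℝ) / M + 2 * θ), Finset.sum_add_distrib,
      ← Finset.sum_div]
    have h2 : ∑ b : Fin L, (cell L (P + b) : ℝ) = L * (e + 2) / 2 := by
      subst hL
      have := sum_cell e P
      push_cast
      linarith
    rw [h2]
    simp
    ring
  rw [Finset.sum_comm]
  have h3 : ∀ k, ∑ a : Fin L × Fin L, ∑ P ∈ crossings L x y k,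
      ((cell L (P + offset a k) : ℝ) / M + 2 * θ) =
      L ^ 2 * ((e + 2) / (2 * M) + 2 * θ) * (crossings L x y k).card := by
    intro k
    rw [Finset.sum_comm, Finset.sum_congr rfl fun P _ => h1 k P]
    simp
    ring
  rw [Finset.sum_congr rfl fun k _ => h3 k, ← Finset.mul_sum]
  refine mul_le_mul_of_nonneg_left ?_ (by positivity)
  calc ∑ k, ((crossings L x y k).card : ℝ) ≤ ∑ k, 2 * |(y - x) k| :=
        Finset.sum_le_sum fun k _ => card_crossings_le hx hy
    _ = 2 * ∑ k, |(y - x) k| := by rw [Finset.mul_sum]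
    _ ≤ 2 * (Real.sqrt 2 * ‖y - x‖) := by gcongr; exact sum_abs_le_norm _
    _ = 2 * Real.sqrt 2 * dist x y := by rw [dist_comm, dist_eq_norm]; ring

/-! ### Portals -/

section

variable {b : Plane × Plane} {k : Fin 2} {u l N : ℝ}

lemma sum_eq_add_rev (k : Fin 2) (f : Fin 2 → ℝ) : ∑ j, f j = f k + f k.rev := by
  match k with
  | 0 => exact Fin.sum_univ_two f
  | 1 => rw [Fin.sum_univ_two, add_comm]; rfl

lemma IsEdge.dist_eq (h : IsEdge b k u l (l + N)) (hN : 0 < N) : dist b.1 b.2 = N := by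
  rw [EuclideanSpace.dist_eq, sum_eq_add_rev k, h.fst, h.snd, h.fst_rev, h.snd_rev, dist_self,
    Real.dist_eq]
  simp [abs_of_pos hN, Real.sqrt_sq hN.le]

lemma IsEdge.pointAt (h : IsEdge b k u l (l + N)) (hN : 0 < N) (s t : ℝ) :
    IsEdge (pointAt b s, pointAt b t) k u (l + s) (l + t) := by
  have hd := h.dist_eq hN
  have h1 : ∀ t j, PortalSnapping.pointAt b t j = b.1 j + t / N * (b.2 j - b.1 j) := by
    intro t j
    simp only [PortalSnapping.pointAt, hd, AffineMap.lineMap_apply, vsub_eq_sub, vadd_eq_add,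
      PiLp.add_apply, PiLp.smul_apply, PiLp.sub_apply, smul_eq_mul]
    ring
  constructor <;> simp only [h1, h.fst, h.snd, h.fst_rev, h.snd_rev]
  · ring
  · ring
  · field_simp; ring
  · field_simp; ring

lemma IsEdge.mem_portals (h : IsEdge b k u l (l + N)) (hN : 0 < N) {M j : ℕ} {δ : ℝ} (hδ : 0 ≤ δ)
    (hj : j ≤ M) {z : Plane} (hz : z k = u) (h1 : l + j * ((N - δ) / M) ≤ z k.rev)
    (h2 : z k.rev ≤ l + j * ((N - δ) / M) + δ) : z ∈ portals b (M + 1) δ := by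
  refine ⟨j, Nat.lt_succ_of_le hj, ?_⟩
  rw [h.dist_eq hN]
  push_cast
  rw [add_sub_cancel_right]
  exact ((h.pointAt hN _ _).mem_segment (by linarith)).2 ⟨hz, h1, by linarith⟩

end

/-! ### Grid lines -/

section

variable {L : ℕ} {a : Fin L × Fin L}

lemma mem_gridLines {g : Set Plane} (hg : g ∈ gridLines a) :
    ∃ k, ∃ n ∈ Finset.Ioo (0 : ℤ) (2 * L), g = {z : Plane | z k = corner a k + n} := by
  obtain ⟨n, h1, h2, rfl | rfl⟩ := hg
  · exact ⟨0, n, Finset.mem_Ioo.2 ⟨by omega, by omega⟩, rfl⟩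
  · exact ⟨1, n, Finset.mem_Ioo.2 ⟨by omega, by omega⟩, rfl⟩

lemma gridLine_mem {n : ℤ} (hn : n ∈ Finset.Ioo (0 : ℤ) (2 * L)) (k : Fin 2) :
    {z : Plane | z k = corner a k + n} ∈ gridLines a := by
  rw [Finset.mem_Ioo] at hn
  lift n to ℕ using hn.1.le
  refine ⟨n, by omega, by omega, ?_⟩
  match k with
  | 0 => exact Or.inl rfl
  | 1 => exact Or.inr rfl

lemma mem_thickening_gridUnion {n : ℤ} (hn : n ∈ Finset.Ioo (0 : ℤ) (2 * L)) {k : Fin 2} {z : Plane}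
    {δ : ℝ} (h : |z k - corner a k - n| < δ) : z ∈ Metric.thickening δ (gridUnion a) := by
  refine Metric.mem_thickening_iff.2
    ⟨z - EuclideanSpace.single k (z k - corner a k - n), ⟨_, gridLine_mem hn k, ?_⟩, ?_⟩
  · simp
    ring
  · rw [dist_eq_norm, sub_sub_cancel]
    simpa using h

end

namespace SnapData

variable {ι : Type*} [Fintype ι] {S : SnapData ι} {ε : ℝ} {i : ι} {k : Fin 2} {n : ℤ} {t : ℝ}

/-- The moved curves avoid the corners of the grid. -/
lemma Fine.moved_rev_ne (hε : S.Fine ε) (ht : t ∈ Icc (0 : ℝ) 1) (h : S.moved ε i t k = n)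
    (m : ℤ) : S.moved ε i t k.rev ≠ m := by
  intro hm
  rcases hε.on_line ht h with ⟨-, h1⟩ | ⟨z, -, -, h1, h2⟩
  · exact S.snap_ne n _ m (h1 ▸ hm)
  · rw [hm] at h1 h2
    have h3 : |m - z| < 1 := by
      have : |(m : ℝ) - z| < 1 := by linarith [hε.lt]
      exact_mod_cast this
    exact h2 (by rw [sub_eq_zero.1 (Int.abs_lt_one_iff.1 h3)])

lemma Fine.moved_eq_start (hε : S.Fine ε) (h : S.pt i t = S.pt i 0) :
    S.moved ε i t = S.pt i 0 := by
  rw [← h]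
  exact hε.moved_eq_pt_of_far fun k n _ => by
    rw [h]; simpa [pt] using hε.lt.le.trans (S.start_far i k n)

lemma Fine.moved_eq_stop (hε : S.Fine ε) (h : S.pt i t = S.pt i 1) :
    S.moved ε i t = S.pt i 1 := by
  rw [← h]
  exact hε.moved_eq_pt_of_far fun k n _ => by
    rw [h]; simpa [pt] using hε.lt.le.trans (S.stop_far i k n)

end SnapData

/-- The point with coordinates `w` relative to the corner of the root square. -/
noncomputable def toPlane {L : ℕ} (a : Fin L × Fin L) (w : Fin 2 → ℝ) : Plane :=
  WithLp.toLp 2 fun k => w k + corner a k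

@[simp] lemma toPlane_apply {L : ℕ} (a : Fin L × Fin L) (w : Fin 2 → ℝ) (k : Fin 2) :
    toPlane a w k = w k + corner a k := rfl

lemma toPlane_injective {L : ℕ} (a : Fin L × Fin L) : Function.Injective (toPlane a) := by
  intro v w h
  ext k
  have := congrArg (fun z : Plane => z k) h
  simpa using this

section

variable {m L : ℕ} {x y : Fin m → Plane}

theorem exists_snapped_curves (hL : ∃ e : ℕ, L = 2 ^ e)
    (hx : ∀ i, x i ∈ Metric.thickening (1 / 4) (lattice L))
    (hy : ∀ i, y i ∈ Metric.thickening (1 / 4) (lattice L)) {M : ℕ} (hM : 0 < M) {θ : ℝ}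
    (hθ : 0 < θ) (hθM : θ * M < 1) {δ : ℝ} (hθδ : θ ≤ δ) {δ' : ℝ} (hδ' : 0 < δ')
    (a : Fin L × Fin L) :
    ∃ s' : (i : Fin m) → Path (x i) (y i),
      (∀ i, range (s' i) \ Metric.thickening δ' (gridUnion a) =
          segment ℝ (x i) (y i) \ Metric.thickening δ' (gridUnion a)) ∧
      ((Pairwise fun i j => Disjoint (segment ℝ (x i) (y i) \ {x i, y i})
            (segment ℝ (x j) (y j) \ {x j, y j})) →
          Pairwise fun i j => Disjoint (range (s' i) \ {x i, y i})
            (range (s' j) \ {x j, y j})) ∧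
      (∀ i, ∀ b : Plane × Plane, IsBoundary a b →
          range (s' i) ∩ segment ℝ b.1 b.2 ⊆ portals b (M + 1) δ) ∧
      (∀ i, ∀ g₁ ∈ gridLines a, ∀ g₂ ∈ gridLines a, g₁ ≠ g₂ → g₁ ∩ g₂ ∩ range (s' i) = ∅) ∧
      ((⋃ i, range (s' i)) ∩ gridUnion a).Finite ∧
      ∀ i, curveLength (s' i) ≤ ENNReal.ofReal (dist (x i) (y i) +
        ∑ k, ∑ P ∈ crossings L (x i) (y i) k, ((cell L (P + offset a k) : ℝ) / M + 2 * θ)) := by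
  have hδ : 0 < δ := hθ.trans_le hθδ
  have hL0 : 0 < L := by
    obtain ⟨e, rfl⟩ := id hL
    positivity
  let S := segmentSnap hL hx hy hM hθ hθM a
  obtain ⟨ε, hε, hεδ, hεδ'⟩ : ∃ ε, S.Fine ε ∧ 1 * ε < δ ∧ 1 * ε < δ' :=
    (S.eventually_fine.and ((SnapData.eventually_mul_lt 1 hδ).and
      (SnapData.eventually_mul_lt 1 hδ'))).exists
  rw [one_mul] at hεδ hεδ'
  have hpt : ∀ i t, toPlane a (S.pt i t) = x i + t • (y i - x i) := by
    intro i t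
    ext k
    rw [toPlane_apply]
    change x i k - corner a k + t * (y i - x i) k + corner a k = x i k + t * (y i - x i) k
    ring
  have hstart : ∀ i, toPlane a (S.pt i 0) = x i := fun i => by rw [hpt]; simp
  have hend : ∀ i, toPlane a (S.pt i 1) = y i := fun i => by rw [hpt]; simp
  have hseg : ∀ i t, t ∈ Icc (0 : ℝ) 1 → toPlane a (S.pt i t) ∈ segment ℝ (x i) (y i) := by
    intro i t ht
    rw [segment_eq_image', hpt]
    exact mem_image_of_mem _ ht
  have hfar : ∀ i t, toPlane a (S.moved ε i t) = toPlane a (S.pt i t) ∨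
      toPlane a (S.moved ε i t) ∈ Metric.thickening δ' (gridUnion a) ∧
        toPlane a (S.pt i t) ∈ Metric.thickening δ' (gridUnion a) := by
    intro i t
    rcases hε.moved_eq_pt_or i t with h | ⟨k, n, hn, hw, h⟩
    · exact Or.inl (by rw [h])
    · refine Or.inr ⟨mem_thickening_gridUnion hn (k := k) ?_,
        mem_thickening_gridUnion hn (k := k) ?_⟩
      · rw [toPlane_apply, add_sub_cancel_right, h]
        exact hw.trans hεδ'
      · rw [toPlane_apply, add_sub_cancel_right]
        exact hw.trans hεδ'
  let γ (i : Fin m) : Path (x i) (y i) :=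
    { toFun := fun t => toPlane a (S.moved ε i t)
      continuous_toFun := by
        refine (PiLp.continuous_toLp 2 _).comp (continuous_pi fun k => ?_)
        exact ((SnapData.continuous_moved i k).comp continuous_subtype_val).add continuous_const
      source' := by
        change toPlane a (S.moved ε i 0) = _
        rw [hε.moved_zero, hstart]
      target' := by
        change toPlane a (S.moved ε i 1) = _
        rw [hε.moved_one, hend] }
  have hγ : ∀ i (t : unitInterval), γ i t = toPlane a (S.moved ε i t) := fun i t => rfl
  refine ⟨γ, fun i => ?_, fun hdisj i j hij => ?_, fun i b hb => ?_, fun i g₁ h₁ g₂ h₂ hne => ?_,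
    ?_, fun i => ?_⟩
  · ext z
    constructor
    · rintro ⟨⟨t, rfl⟩, hz⟩
      refine ⟨?_, hz⟩
      rw [hγ] at hz ⊢
      rcases hfar i t with h | h
      · rw [h]; exact hseg i t t.2
      · exact absurd h.1 hz
    · rintro ⟨hz, hz'⟩
      refine ⟨?_, hz'⟩
      rw [segment_eq_image'] at hz
      obtain ⟨t, ht, rfl⟩ := hz
      refine ⟨⟨t, ht⟩, ?_⟩
      rw [hγ]
      change _ = x i + t • (y i - x i)
      change x i + t • (y i - x i) ∉ _ at hz'
      rw [← hpt] at hz' ⊢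
      rcases hfar i t with h | h
      · exact h
      · exact absurd h.2 hz'
  -- Comparing points instead of parameters also covers degenerate segments with `x i = y i`.
  · have hmem : ∀ i (t : unitInterval), γ i t ∉ ({x i, y i} : Set Plane) →
        toPlane a (S.pt i t) ∈ segment ℝ (x i) (y i) \ {x i, y i} := by
      intro i t ht
      refine ⟨hseg i t t.2, fun h => ht ?_⟩
      rcases h with h | h
      · left
        rw [← hstart i] at h
        rw [hγ, hε.moved_eq_start (toPlane_injective a h), hstart]
      · right
        rw [mem_singleton_iff, ← hend i] at h
        rw [mem_singleton_iff, hγ, hε.moved_eq_stop (toPlane_injective a h), hend]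
    refine Set.disjoint_left.2 ?_
    rintro z ⟨⟨t, rfl⟩, hz⟩ ⟨⟨s, hs⟩, hz'⟩
    have he : S.moved ε i t = S.moved ε j s := toPlane_injective a hs.symm
    have h1 := hmem i t hz
    rw [← hs] at hz'
    have h2 := hmem j s hz'
    rw [hε.pt_eq_of_moved_eq t.2 s.2 he] at h1
    exact Set.disjoint_left.1 (hdisj hij) h1 h2
  · rintro z ⟨⟨t, rfl⟩, hz⟩
    obtain ⟨k, n, c, hn0, hn1, hE⟩ := hb.exists_isEdge hL
    have hN : (1 : ℝ) ≤ cell L n := by exact_mod_cast cell_pos (n := n) hL0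
    rw [hE.mem_segment (by linarith)] at hz
    obtain ⟨h1, h2, h3⟩ := hz
    rw [mul_add, mul_one, ← add_assoc] at hE
    have h1' := h1
    rw [hγ, toPlane_apply, add_comm, add_left_cancel_iff] at h1
    have h4 : γ i t k.rev = S.moved ε i t k.rev + corner a k.rev := rfl
    have hM' : (M : ℝ) ≠ 0 := by positivity
    rcases hε.on_line t.2 h1 with ⟨-, h⟩ | ⟨z, -, hbeats, hlt, -⟩
    · change _ = snapMap (cell L n) M θ (S.pos i k n) at h
      set v := S.pos i k n
      have hθ1 : θ < 1 := by
        have : (1 : ℝ) ≤ M := by exact_mod_cast hM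
        nlinarith
      obtain ⟨h5, h6⟩ := snapMap_mem (v := v) (cell_pos (n := n) hL0) hM hθ hθ1
      obtain ⟨h7, h8⟩ := snapMap_mem_portal (N := cell L n) (v := v) hM hθ hθδ
      rw [← h] at h5 h6 h7 h8
      -- The snapped position is strictly inside its cell, so it lies on no other boundary of this
      -- line.
      have hc : c = ⌊v / cell L n⌋ := by
        have h9 : (c : ℝ) < ⌊v / cell L n⌋ + 1 := by
          refine lt_of_mul_lt_mul_left ?_ (zero_le_one.trans hN)
          linarith
        have h10 : (⌊v / cell L n⌋ : ℝ) < c + 1 := by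
          refine lt_of_mul_lt_mul_left ?_ (zero_le_one.trans hN)
          linarith
        norm_cast at h9 h10
        omega
      have hj : ((portalIndex (cell L n) M v).toNat : ℝ) = portalIndex (cell L n) M v := by
        exact_mod_cast Int.toNat_of_nonneg portalIndex_nonneg
      refine hE.mem_portals (by linarith) hδ.le (j := (portalIndex (cell L n) M v).toNat) ?_ h1' ?_ ?_
      · exact Int.toNat_le.2 portalIndex_le
      · rw [hj, h4, hc]; linarith
      · rw [hj, h4, hc]; linarith
    · obtain ⟨d, rfl⟩ : (cell L n : ℤ) ∣ z := cellBeats.dvd hL hbeats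
      push_cast at hlt
      obtain ⟨h5, h6⟩ := abs_lt.1 hlt
      have hε1 := hε.lt
      -- The point is within `ε` of a multiple of the boundary length, so this multiple is one of
      -- the two ends; since `ε < δ`, the first or the last portal contains the point.
      have hd : d = c ∨ d = c + 1 := by
        have h9 : (c : ℝ) < d + 1 := by
          refine lt_of_mul_lt_mul_left ?_ (zero_le_one.trans hN)
          linarith
        have h10 : (d : ℝ) < c + 2 := by
          refine lt_of_mul_lt_mul_left ?_ (zero_le_one.trans hN)
          linarith
        norm_cast at h9 h10
        omega
      rcases hd with rfl | rfl
      · refine hE.mem_portals (by linarith) hδ.le (Nat.zero_le M) h1' ?_ ?_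
        · simpa using h2
        · rw [h4]
          push_cast
          linarith
      · push_cast at h5 h6
        refine hE.mem_portals (by linarith) hδ.le (le_refl M) h1' ?_ ?_
        · rw [h4, mul_div_cancel₀ _ hM']
          linarith
        · rw [mul_div_cancel₀ _ hM']
          linarith
  · rw [Set.eq_empty_iff_forall_notMem]
    rintro z ⟨⟨hz₁, hz₂⟩, t, rfl⟩
    obtain ⟨k, n, -, rfl⟩ := mem_gridLines h₁
    obtain ⟨l, n', -, rfl⟩ := mem_gridLines h₂
    rw [mem_ofPred_eq, hγ, toPlane_apply, add_comm, add_left_cancel_iff] at hz₁ hz₂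
    rcases eq_or_eq_rev k l with rfl | rfl
    · rw [hz₁] at hz₂
      exact hne (by rw [hz₂])
    · exact hε.moved_rev_ne t.2 hz₁ n' hz₂
  · have hfin : (⋃ i, (fun t => toPlane a (S.moved ε i t)) '' {t ∈ Icc (0 : ℝ) 1 |
        ∃ k, ∃ n ∈ Finset.Ioo (0 : ℤ) (2 * L), S.moved ε i t k = n}).Finite :=
      finite_iUnion fun i => (hε.finite_times i _).image _
    refine hfin.subset ?_
    rintro z ⟨hz, g, hg, hzg⟩
    obtain ⟨i, t, rfl⟩ := mem_iUnion.1 hz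
    obtain ⟨k, n, hn, rfl⟩ := mem_gridLines hg
    rw [mem_ofPred_eq, hγ, toPlane_apply, add_comm, add_left_cancel_iff] at hzg
    exact mem_iUnion.2 ⟨i, t, ⟨t.2, k, n, hn, hzg⟩, rfl⟩
  · refine (SnapData.eVariationOn_moved_le (S := S) hε.pos (d := y i - x i) (fun k => rfl)
      (corner a) (f := γ i) (fun t k => rfl)).trans (ENNReal.ofReal_le_ofReal ?_)
    rw [dist_comm, dist_eq_norm]
    exact add_le_add le_rfl (Finset.sum_le_sum fun k _ => sum_shift_segmentSnap_le)

end

/-- The left side equals `(M + 1 + 2r + 2δr) / M`. As `2r ≤ M + 1`, this is at most `3(M + 1) / M`,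
and `M ≥ 1` suffices for the bound. -/
lemma cost_factor_le {r e M : ℕ} {δ : ℝ} (hM : r * e = M + 1) (he : 2 ≤ e) (hr : 1 ≤ r)
    (hδ : δ ≤ 1) : (((e : ℝ) + 2) / (2 * M) + 2 * (δ / (2 * M))) * (2 * r) ≤ 7 := by
  have hM2 : 2 * r ≤ M + 1 := by rw [← hM, mul_comm]; exact Nat.mul_le_mul_left _ he
  have hM0 : (0 : ℝ) < M := by
    have : 0 < M := by omega
    exact_mod_cast this
  have h9 : (r : ℝ) * e = M + 1 := by exact_mod_cast hM
  have h10 : 2 * (r : ℝ) ≤ M + 1 := by exact_mod_cast hM2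
  have h11 : (1 : ℝ) ≤ r := by exact_mod_cast hr
  have h12 : (((e : ℝ) + 2) / (2 * M) + 2 * (δ / (2 * M))) * (2 * r) =
      (r * e + 2 * r + 2 * (δ * r)) / M := by
    field_simp
  rw [h12, div_le_iff₀ hM0, h9]
  have h13 := mul_le_of_le_one_left (zero_le_one.trans h11) hδ
  linarith

end PortalSnapping

theorem mainTheorem6 (L : ℕ) (hLpow : ∃ n : ℕ, L = 2 ^ n) (hL : 4 ≤ L)
    (m : ℕ) (x y : Fin m → Plane)
    (hx : ∀ i, x i ∈ Metric.thickening (1 / 4) (lattice L))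
    (hy : ∀ i, y i ∈ Metric.thickening (1 / 4) (lattice L))
    (r : ℕ) (hr : r ≠ 0) (δ : ℝ) (hδ : δ ∈ Set.Ioo (0 : ℝ) 1) (δ' : ℝ) (hδ' : 0 < δ') :
    ∃ s' : Fin L × Fin L → (i : Fin m) → Path (x i) (y i),
      (∀ a : Fin L × Fin L,
        -- a) the curves differ from the segments only near the grid lines
        (∀ i, Set.range (s' a i) \ Metric.thickening δ' (gridUnion a) =
          segment ℝ (x i) (y i) \ Metric.thickening δ' (gridUnion a)) ∧
        -- b) disjointness of the interiors is preserved
        ((Pairwise fun i j => Disjoint (segment ℝ (x i) (y i) \ {x i, y i})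
            (segment ℝ (x j) (y j) \ {x j, y j})) →
          Pairwise fun i j => Disjoint (Set.range (s' a i) \ {x i, y i})
            (Set.range (s' a j) \ {x j, y j})) ∧
        -- c) boundaries are met only in their portals
        (∀ i, ∀ b : Plane × Plane, IsBoundary a b →
          Set.range (s' a i) ∩ segment ℝ b.1 b.2 ⊆ portals b (r * Nat.log 2 L) δ) ∧
        -- d) no intersection point of two grid lines is met
        (∀ i, ∀ g₁ ∈ gridLines a, ∀ g₂ ∈ gridLines a, g₁ ≠ g₂ →
          g₁ ∩ g₂ ∩ Set.range (s' a i) = ∅) ∧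
        -- e) the grid lines are met in finitely many points
        ((⋃ i, Set.range (s' a i)) ∩ gridUnion a).Finite ∧
        -- the curves have finite length
        (∀ i, curveLength (s' a i) ≠ ⊤)) ∧
      -- f) the expected increase of the total length, for uniformly random `a`
      (∑ a : Fin L × Fin L,
          ((∑ i, (curveLength (s' a i)).toReal) - ∑ i, dist (x i) (y i))) / (L : ℝ) ^ 2 ≤
        7 * Real.sqrt 2 * ((∑ i, dist (x i) (y i)) / r) := by
  obtain ⟨e, he⟩ := id hLpow
  have hlog : Nat.log 2 L = e := by rw [he]; exact Nat.log_pow (by norm_num) e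
  have he2 : 2 ≤ e := by
    by_contra h
    have : e = 0 ∨ e = 1 := by omega
    rcases this with rfl | rfl <;> norm_num at he <;> omega
  obtain ⟨M, hM⟩ : ∃ M, r * e = M + 1 :=
    Nat.exists_eq_succ_of_ne_zero (Nat.mul_ne_zero hr (by omega))
  have hr1 : 1 ≤ r := Nat.one_le_iff_ne_zero.2 hr
  have hM2 : 2 * r ≤ M + 1 := by rw [← hM, mul_comm]; exact Nat.mul_le_mul_left _ he2
  have hM0 : 0 < M := by omega
  have hM1 : (1 : ℝ) ≤ M := by exact_mod_cast hM0
  -- This gives `θ * M = δ / 2 < 1`, as needed to avoid the corners, and makes the additive cost `2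
  -- * θ = δ / M` comparable to the other term.
  set θ : ℝ := δ / (2 * M) with hθdef
  have hθM' : θ * M = δ / 2 := by rw [hθdef]; field_simp
  have hθ : 0 < θ := div_pos hδ.1 (by positivity)
  have hθM : θ * M < 1 := by rw [hθM']; linarith [hδ.2]
  have hθδ : θ ≤ δ := by nlinarith [hδ.1]
  choose s' h1 h2 h3 h4 h5 h6 using
    exists_snapped_curves (x := x) (y := y) hLpow hx hy hM0 hθ hθM hθδ hδ'
  refine ⟨s', fun a => ⟨h1 a, h2 a, ?_, h4 a, h5 a,
    fun i => ne_top_of_le_ne_top ENNReal.ofReal_ne_top (h6 a i)⟩, ?_⟩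
  · rw [hlog, hM]
    exact h3 a
  · have hL0 : (0 : ℝ) < L := by positivity
    have hκ := cost_factor_le hM he2 hr1 hδ.2.le
    rw [← hθdef] at hκ
    generalize hκdef : ((e : ℝ) + 2) / (2 * M) + 2 * θ = κ at hκ
    have hinc : ∀ a : Fin L × Fin L, (∑ i, (curveLength (s' a i)).toReal) -
        ∑ i, dist (x i) (y i) ≤ ∑ i, ∑ k, ∑ P ∈ crossings L (x i) (y i) k,
          ((cell L (P + offset a k) : ℝ) / M + 2 * θ) := by
      intro a
      rw [← Finset.sum_sub_distrib]
      refine Finset.sum_le_sum fun i _ => ?_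
      have h8 : ∀ k, 0 ≤ ∑ P ∈ crossings L (x i) (y i) k,
          ((cell L (P + offset a k) : ℝ) / M + 2 * θ) := fun k =>
        Finset.sum_nonneg fun P _ => add_nonneg (by positivity) (by linarith)
      have h7 := ENNReal.toReal_le_of_le_ofReal
        (add_nonneg dist_nonneg (Finset.sum_nonneg fun k _ => h8 k)) (h6 a i)
      linarith
    rw [div_le_iff₀ (by positivity)]
    calc ∑ a : Fin L × Fin L, ((∑ i, (curveLength (s' a i)).toReal) - ∑ i, dist (x i) (y i))
        ≤ ∑ a : Fin L × Fin L, ∑ i, ∑ k, ∑ P ∈ crossings L (x i) (y i) k,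
          ((cell L (P + offset a k) : ℝ) / M + 2 * θ) := Finset.sum_le_sum fun a _ => hinc a
      _ = ∑ i, ∑ a : Fin L × Fin L, ∑ k, ∑ P ∈ crossings L (x i) (y i) k,
          ((cell L (P + offset a k) : ℝ) / M + 2 * θ) := Finset.sum_comm
      _ ≤ ∑ i, (L : ℝ) ^ 2 * κ * (2 * Real.sqrt 2 * dist (x i) (y i)) :=
        Finset.sum_le_sum fun i _ => hκdef ▸ sum_sum_crossings_le he (hx i) (hy i) hθ
      _ = κ * (2 * r) * (Real.sqrt 2 * ((∑ i, dist (x i) (y i)) / r) * (L : ℝ) ^ 2) := by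
        have hr0 : (r : ℝ) ≠ 0 := by exact_mod_cast hr
        rw [← Finset.mul_sum, ← Finset.mul_sum]
        generalize ∑ i, dist (x i) (y i) = d
        field_simp
      _ ≤ 7 * (Real.sqrt 2 * ((∑ i, dist (x i) (y i)) / r) * (L : ℝ) ^ 2) := by
        have : 0 ≤ ∑ i, dist (x i) (y i) := Finset.sum_nonneg fun i _ => dist_nonneg
        exact mul_le_mul_of_nonneg_right hκ (by positivity)
      _ = 7 * Real.sqrt 2 * ((∑ i, dist (x i) (y i)) / r) * (L : ℝ) ^ 2 := by ring
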